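/- Let $(M,g)$ be a smooth Riemannian manifold of dimension $n\ge 3$ and of constant curvature, with Levi-Civita connection $\nabla$ (covariant derivatives are denoted by a comma), Riemann tensor $R_{ijkl}$ with the sign convention $R_{ijkl}=\kappa\,(g_{ik}g_{jl}-g_{il}g_{jk})$ for constant curvature $\kappa$, Ricci tensor $R_{ij}=R^a{}_{iaj}$, scalar curvature $R=R^{ab}{}_{ab}$ and Weyl tensor $W_{ijkl}$. Let $T_{ijk}$ be a smooth tensor field which has the algebraic properties of a structure tensor: it is symmetric and trace-free in its first two indices, and $T_{ijk}+\frac1{n-1}g_{ij}t_k$ is symmetric in $(j,k)$, where $t_j=T_{ij}{}^{i}$. Put $$\mathring T_{ijk}=\text{the totally symmetric trace-free part of }T_{ijk},\qquad \bar t_i=\frac{n}{(n+2)(n-1)}\,T_{ij}{}^{j}.$$ Write $\operatorname{Sym}_{ijk}$ for the sum over the six permutations of $i,j,k$, and a subscript $\circ$ for the completely trace-free part (in $i,j,k$ for $\operatorname{Sym}_{ijk}$); $\mathring R_{ij}$ and $\mathring Z_{ij}$ are the trace-free parts of $R_{ij}$ and $Z_{ij}$. Suppose that everywhere on $M$ $$T_{ijk,l}=\mathring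 T_{ijk,l}+\bar t_{i,l}g_{jk}+\bar t_{j,l}g_{ik}-\frac2n\,g_{ij}\bar t_{k,l},$$ $$\mathring T_{ijk,l}=\frac1{18}\Bigl(\operatorname{Sym}_{ijk}\Bigl[\mathring T_{ij}{}^{a}\mathring T_{kla}+\mathring T_{ijk}\bar t_l+3\mathring T_{ijl}\bar t_k+\Bigl(\frac4{n-2}\mathring T_i{}^{ab}\mathring T_{jab}-3\mathring T_{ij}{}^{a}\bar t_a\Bigr)g_{kl}\Bigr]\Bigr)_\circ,$$ $$\bar t_{k,l}=\frac13\Bigl(-\frac2{n-2}\mathring T_k{}^{ab}\mathring T_{lab}+3\mathring T_{kl}{}^{a}\bar t_a+4\bar t_k\bar t_l\Bigr)_\circ+\frac1n g_{kl}\Bigl(\frac{3n+2}{6(n+2)(n-1)}\mathring T^{abc}\mathring T_{abc}-\frac{n-2}6\bar t^a\bar t_a+\frac3{2(n-1)}R\Bigr),$$ together with $$\frac18\bigl(\mathcal Y\,[T^a{}_{ik}T_{ajl}]\bigr)_\circ=W_{ijkl}=0,\qquad -\frac14\mathring Z_{ij}=\mathring R_{ij},$$ where $\mathcal Y$ symmetrises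 in $(i,k)$ and in $(j,l)$ and then antisymmetrises in $(i,j)$ and in $(k,l)$ (all without normalisation), and $$Z_{ij}=\mathring T_i{}^{ab}\mathring T_{jab}-(n-2)\bigl(\mathring T_{ij}{}^{a}\bar t_a+\bar t_i\bar t_j\bigr)-R_{ij}.$$ Then, everywhere on $M$, $$\mathring T^{abc}\mathring T_{abc}-(n-1)(n+2)\,\bar t^a\bar t_a=9R.$$ -/

import Mathlib

open Bundle Manifold
open scoped ContDiff Topology

noncomputable section

namespace Superintegrable

/-! ## Index calculus

Components with respect to an orthonormal basis.  Since `g_{ij} = δ_{ij}` there, all indices are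
lowered and a contraction is a plain sum over a repeated index. -/

section Components

variable {n : ℕ}

/-- The components `g_{ij} = δ_{ij}` of the metric in an orthonormal basis. -/
def gg (i j : Fin n) : ℝ := if i = j then 1 else 0

/-- The complete symmetriser: the sum over all six permutations of the three indices
(not normalised). -/
def symm3 (A : Fin n → Fin n → Fin n → ℝ) : Fin n → Fin n → Fin n → ℝ :=
  fun i j k => A i j k + A i k j + A k i j + A k j i + A j k i + A j i k

/-- The trace-free part of a totally symmetric tensor of valence three. -/
def traceFree3 (A : Fin n → Fin n → Fin n → ℝ) : Fin n → Fin n → Fin n → ℝ :=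
  fun i j k => A i j k - 1 / ((n : ℝ) + 2) *
    (gg i j * ∑ a, A a a k + gg j k * ∑ a, A a a i + gg k i * ∑ a, A a a j)

/-- The complete symmetriser followed by the projection onto the trace-free part. -/
def symm3Free (A : Fin n → Fin n → Fin n → ℝ) : Fin n → Fin n → Fin n → ℝ :=
  traceFree3 (symm3 A)

/-- The trace-free part of a symmetric tensor of valence two. -/
def traceFree2 (A : Fin n → Fin n → ℝ) : Fin n → Fin n → ℝ :=
  fun i j => A i j - 1 / (n : ℝ) * gg i j * ∑ a, A a a

/-- `T̊_{ijk}`, the totally symmetric trace-free part of `T_{ijk}`. -/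
def ring3 (T : Fin n → Fin n → Fin n → ℝ) : Fin n → Fin n → Fin n → ℝ :=
  fun i j k => 1 / 6 * symm3Free T i j k

/-- The trace `t_j = T_{ij}^i`. -/
def tr (T : Fin n → Fin n → Fin n → ℝ) : Fin n → ℝ :=
  fun j => ∑ i, T i j i

/-- The rescaled trace `t̄_i = n / ((n + 2) (n - 1)) T_{ij}^j`. -/
def tbar (T : Fin n → Fin n → Fin n → ℝ) : Fin n → ℝ :=
  fun i => (n : ℝ) / (((n : ℝ) + 2) * ((n : ℝ) - 1)) * ∑ j, T i j j

/-- `S_i^{ab} S_{jab}`. -/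
def sq2 (S : Fin n → Fin n → Fin n → ℝ) : Fin n → Fin n → ℝ :=
  fun i j => ∑ a, ∑ b, S i a b * S j a b

/-- `S^{abc} S_{abc}`. -/
def sq3 (S : Fin n → Fin n → Fin n → ℝ) : ℝ := ∑ a, ∑ b, ∑ c, S a b c * S a b c

/-- `t^a t_a`. -/
def sq1 (t : Fin n → ℝ) : ℝ := ∑ a, t a * t a

/-- `S_{ij}^a t_a`. -/
def contr (S : Fin n → Fin n → Fin n → ℝ) (t : Fin n → ℝ) : Fin n → Fin n → ℝ :=
  fun i j => ∑ a, S i j a * t a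

/-- The Ricci contraction `C_{ij} = C^a_{iaj}`. -/
def ricci (C : Fin n → Fin n → Fin n → Fin n → ℝ) : Fin n → Fin n → ℝ :=
  fun i j => ∑ a, C a i a j

/-- The scalar contraction `C^{ab}_{ab}`. -/
def scal (C : Fin n → Fin n → Fin n → Fin n → ℝ) : ℝ := ∑ a, ∑ b, C a b a b

/-- The completely trace-free (Weyl) part of an algebraic curvature tensor `C_{ijkl}`
(antisymmetric in `(i,j)` and in `(k,l)`). -/
def weyl (C : Fin n → Fin n → Fin n → Fin n → ℝ) : Fin n → Fin n → Fin n → Fin n → ℝ :=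
  fun i j k l => C i j k l
    - 1 / ((n : ℝ) - 2) *
      (ricci C i k * gg j l + ricci C j l * gg i k - ricci C i l * gg j k - ricci C j k * gg i l)
    + scal C / (((n : ℝ) - 1) * ((n : ℝ) - 2)) * (gg i k * gg j l - gg i l * gg j k)

/-- The adjoint Young operator of the tableau with rows `i k` and `j l`: symmetrise in `(i,k)` and
in `(j,l)`, then antisymmetrise in `(i,j)` and in `(k,l)` (not normalised). -/
def youngWindow (X : Fin n → Fin n → Fin n → Fin n → ℝ) : Fin n → Fin n → Fin n → Fin n → ℝ :=
  let Y : Fin n → Fin n → Fin n → Fin n → ℝ :=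
    fun i j k l => X i j k l + X k j i l + X i l k j + X k l i j
  fun i j k l => Y i j k l - Y j i k l - Y i j l k + Y j i l k

/-- The tensor `Z_{ij} = T̊_i^{ab} T̊_{jab} - (n-2) (T̊_{ij}^a t̄_a + t̄_i t̄_j) - R_{ij}` built from
the components of `T` and of the Riemann tensor `R`. -/
def Zten (T : Fin n → Fin n → Fin n → ℝ) (R : Fin n → Fin n → Fin n → Fin n → ℝ) :
    Fin n → Fin n → ℝ :=
  fun i j => sq2 (ring3 T) i j
    - ((n : ℝ) - 2) * (contr (ring3 T) (tbar T) i j + tbar T i * tbar T j) - ricci R i j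

/-- The polynomial conditions
`1/8 Young*_∘ (T^a_{ik} T_{ajl}) = W_{ijkl} = 0` and `-1/4 Z̊_{ij} = R̊_{ij}`. -/
def PolynomialEquations (T : Fin n → Fin n → Fin n → ℝ)
    (R : Fin n → Fin n → Fin n → Fin n → ℝ) : Prop :=
  (∀ i j k l, 1 / 8 * weyl (youngWindow fun i j k l => ∑ a, T a i k * T a j l) i j k l
      = weyl R i j k l) ∧
  (∀ i j k l, weyl R i j k l = 0) ∧
  (∀ i j, -(1 / 4) * traceFree2 (Zten T R) i j = traceFree2 (ricci R) i j)

/-- The right hand side of the formula for `T̊_{ijk,l}`, in terms of `S = T̊` and `t = t̄`. -/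
def rhsRing (S : Fin n → Fin n → Fin n → ℝ) (t : Fin n → ℝ) (i j k l : Fin n) : ℝ :=
  1 / 18 * symm3Free (fun i j k =>
      (∑ a, S i j a * S k l a) + S i j k * t l + 3 * S i j l * t k
        + (4 / ((n : ℝ) - 2) * sq2 S i j - 3 * contr S t i j) * gg k l) i j k

/-- The right hand side of the formula for `t̄_{k,l}`, in terms of `S = T̊`, `t = t̄` and the scalar
curvature `R`. -/
def rhsTbar (S : Fin n → Fin n → Fin n → ℝ) (t : Fin n → ℝ) (R : ℝ) (k l : Fin n) : ℝ :=
  1 / 3 * traceFree2 (fun k l =>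
      -(2 / ((n : ℝ) - 2)) * sq2 S k l + 3 * contr S t k l + 4 * t k * t l) k l
    + 1 / (n : ℝ) * gg k l *
      ((3 * (n : ℝ) + 2) / (6 * ((n : ℝ) + 2) * ((n : ℝ) - 1)) * sq3 S
        - ((n : ℝ) - 2) / 6 * sq1 t + 3 / (2 * ((n : ℝ) - 1)) * R)

end Components

/-! ## Geometry -/

section Geometry

variable {n : ℕ} {E : Type*} [NormedAddCommGroup E] [NormedSpace ℝ E] [FiniteDimensional ℝ E]
  {M : Type*} [TopologicalSpace M] [ChartedSpace E M]
  [IsManifold 𝓘(ℝ, E) ∞ M] [RiemannianBundle (fun x : M => TangentSpace 𝓘(ℝ, E) x)]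
  [IsContMDiffRiemannianBundle 𝓘(ℝ, E) ∞ E
    (fun x : M => TangentSpace 𝓘(ℝ, E) x)]

/-- A connection on the tangent bundle is the Levi-Civita connection if it is compatible with the
Riemannian metric, `u (g(X,Y)) = g(∇_u X, Y) + g(X, ∇_u Y)`, and torsion-free. -/
def IsLeviCivita
    (cov : CovariantDerivative 𝓘(ℝ, E) E
      (fun x : M => TangentSpace 𝓘(ℝ, E) x)) : Prop :=
  (∀ (x : M) (u : TangentSpace 𝓘(ℝ, E) x) (X Y : Π y : M, TangentSpace 𝓘(ℝ, E) y),
      MDiffAt (T% X) x → MDiffAt (T% Y) x →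
      mvfderiv 𝓘(ℝ, E) (fun y => inner ℝ (X y) (Y y)) x u
        = inner ℝ (cov X x u) (Y x) + inner ℝ (X x) (cov Y x u)) ∧
  cov.torsion = 0

/-- The curvature `R(X,Y)Z = ∇_X ∇_Y Z - ∇_Y ∇_X Z - ∇_{[X,Y]} Z` of a connection at `x`, computed
on smooth extensions of the tangent vectors `u, v, w` to vector fields `X, Y, Z` near `x`. -/
def curvature
    (cov : CovariantDerivative 𝓘(ℝ, E) E
      (fun x : M => TangentSpace 𝓘(ℝ, E) x))
    (x : M) (u v w : TangentSpace 𝓘(ℝ, E) x) : TangentSpace 𝓘(ℝ, E) x :=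
  let X : Π y : M, TangentSpace 𝓘(ℝ, E) y := FiberBundle.extend E u
  let Y : Π y : M, TangentSpace 𝓘(ℝ, E) y := FiberBundle.extend E v
  let Z : Π y : M, TangentSpace 𝓘(ℝ, E) y := FiberBundle.extend E w
  cov (fun y => cov Z y (Y y)) x (X x) - cov (fun y => cov Z y (X y)) x (Y x)
    - cov Z x (VectorField.mlieBracket 𝓘(ℝ, E) X Y x)

/-- The components `R_{ijkl} = g(R(v_k, v_l) v_j, v_i)` of the Riemann tensor; with this convention
`R_{ijkl} = κ (g_{ik} g_{jl} - g_{il} g_{jk})` on a manifold of constant curvature `κ`. -/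
def riem
    (cov : CovariantDerivative 𝓘(ℝ, E) E
      (fun x : M => TangentSpace 𝓘(ℝ, E) x))
    (x : M) (v : Fin n → TangentSpace 𝓘(ℝ, E) x) : Fin n → Fin n → Fin n → Fin n → ℝ :=
  fun i j k l => inner ℝ (curvature cov x (v k) (v l) (v j)) (v i)

/-- Constant curvature: `R(u,v)w = κ (g(v,w) u - g(u,w) v)` for a constant `κ`. -/
def HasConstantCurvature
    (cov : CovariantDerivative 𝓘(ℝ, E) E
      (fun x : M => TangentSpace 𝓘(ℝ, E) x)) : Prop :=
  ∃ κ : ℝ, ∀ (x : M) (u v w : TangentSpace 𝓘(ℝ, E) x),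
    curvature cov x u v w = κ • (inner ℝ v w • u - inner ℝ u w • v)

/-- The components `T_{ijk}(x)` with respect to the tangent vectors `v_i` at `x`. -/
def comp
    (T : Π x : M, TangentSpace 𝓘(ℝ, E) x →L[ℝ] TangentSpace 𝓘(ℝ, E) x →L[ℝ]
      TangentSpace 𝓘(ℝ, E) x →L[ℝ] ℝ)
    (x : M) (v : Fin n → TangentSpace 𝓘(ℝ, E) x) : Fin n → Fin n → Fin n → ℝ :=
  fun i j k => T x (v i) (v j) (v k)

/-- The tensor field `T` is smooth: it takes smooth values on smooth local vector fields. -/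
def IsSmoothTensor
    (T : Π x : M, TangentSpace 𝓘(ℝ, E) x →L[ℝ] TangentSpace 𝓘(ℝ, E) x →L[ℝ]
      TangentSpace 𝓘(ℝ, E) x →L[ℝ] ℝ) : Prop :=
  ∀ (x : M) (X Y Z : Π y : M, TangentSpace 𝓘(ℝ, E) y),
    CMDiffAt ∞ (T% X) x → CMDiffAt ∞ (T% Y) x → CMDiffAt ∞ (T% Z) x →
      CMDiffAt ∞ (fun y => T y (X y) (Y y) (Z y)) x

/-- A smooth orthonormal frame of the tangent bundle on a neighbourhood of `x`. -/
def IsOrthonormalFrameAt (e : Fin n → Π y : M, TangentSpace 𝓘(ℝ, E) y) (x : M) : Prop :=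
  (∀ i, CMDiffAt ∞ (T% (e i)) x) ∧ ∀ᶠ y in 𝓝 x, Orthonormal ℝ (fun i => e i y)

/-- The connection coefficients `g(∇_{e_l} e_i, e_a)` in a frame `e`. -/
def connCoeff
    (cov : CovariantDerivative 𝓘(ℝ, E) E
      (fun x : M => TangentSpace 𝓘(ℝ, E) x))
    (e : Fin n → Π y : M, TangentSpace 𝓘(ℝ, E) y) (x : M) (l i a : Fin n) : ℝ :=
  inner ℝ (cov (e i) x (e l x)) (e a x)

/-- The components `a_{k,l}` of the covariant derivative of a one-form with components `a_k` in an
orthonormal frame `e`. -/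
def covD1
    (cov : CovariantDerivative 𝓘(ℝ, E) E
      (fun x : M => TangentSpace 𝓘(ℝ, E) x))
    (e : Fin n → Π y : M, TangentSpace 𝓘(ℝ, E) y) (a : M → Fin n → ℝ) (x : M) (k l : Fin n) : ℝ :=
  mvfderiv 𝓘(ℝ, E) (fun y => a y k) x (e l x) - ∑ m, connCoeff cov e x l k m * a x m

/-- The components `A_{ijk,l}` of the covariant derivative of a tensor field of valence three with
components `A_{ijk}` in an orthonormal frame `e`. -/
def covD3
    (cov : CovariantDerivative 𝓘(ℝ, E) E
      (fun x : M => TangentSpace 𝓘(ℝ, E) x))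
    (e : Fin n → Π y : M, TangentSpace 𝓘(ℝ, E) y) (A : M → Fin n → Fin n → Fin n → ℝ) (x : M)
    (i j k l : Fin n) : ℝ :=
  mvfderiv 𝓘(ℝ, E) (fun y => A y i j k) x (e l x)
    - ∑ m, (connCoeff cov e x l i m * A x m j k + connCoeff cov e x l j m * A x i m k
      + connCoeff cov e x l k m * A x i j m)

/-- The formulas for the covariant derivatives of `T`, `T̊` and `t̄` at `x`, written in an
orthonormal frame `e` near `x`. -/
def DerivativeEquations
    (cov : CovariantDerivative 𝓘(ℝ, E) E
      (fun x : M => TangentSpace 𝓘(ℝ, E) x))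
    (T : Π x : M, TangentSpace 𝓘(ℝ, E) x →L[ℝ] TangentSpace 𝓘(ℝ, E) x →L[ℝ]
      TangentSpace 𝓘(ℝ, E) x →L[ℝ] ℝ)
    (e : Fin n → Π y : M, TangentSpace 𝓘(ℝ, E) y) (x : M) : Prop :=
  let Tc : M → Fin n → Fin n → Fin n → ℝ := fun y => comp T y (fun i => e i y)
  let S : M → Fin n → Fin n → Fin n → ℝ := fun y => ring3 (Tc y)
  let t : M → Fin n → ℝ := fun y => tbar (Tc y)
  (∀ i j k l, covD3 cov e Tc x i j k l = covD3 cov e S x i j k l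
      + (covD1 cov e t x i l * gg j k + covD1 cov e t x j l * gg i k
        - 2 / (n : ℝ) * gg i j * covD1 cov e t x k l)) ∧
  (∀ i j k l, covD3 cov e S x i j k l = rhsRing (S x) (t x) i j k l) ∧
  (∀ k l, covD1 cov e t x k l
      = rhsTbar (S x) (t x) (scal (riem cov x (fun i => e i x))) k l)

/-- The algebraic properties of a structure tensor: symmetric and trace-free in the first two
indices, and the first (linear) integrability condition
`T_{ijk} + g_{ij} t_k / (n-1) = T_{ikj} + g_{ik} t_j / (n-1)`. -/
def IsStructureTensor
    (T : Π x : M, TangentSpace 𝓘(ℝ, E) x →L[ℝ] TangentSpace 𝓘(ℝ, E) x →L[ℝ]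
      TangentSpace 𝓘(ℝ, E) x →L[ℝ] ℝ) : Prop :=
  ∀ (x : M) (b : OrthonormalBasis (Fin n) ℝ (TangentSpace 𝓘(ℝ, E) x)),
    (∀ i j k, comp T x b j i k = comp T x b i j k) ∧
    (∀ k, ∑ i, comp T x b i i k = 0) ∧
    (∀ i j k, comp T x b i j k + 1 / ((n : ℝ) - 1) * gg i j * tr (comp T x b) k
      = comp T x b i k j + 1 / ((n : ℝ) - 1) * gg i k * tr (comp T x b) j)

end Geometry

end Superintegrable

end

noncomputable section

namespace Superintegrable

/-! ### Metric contractions, Kulkarni-Nomizu products and the Weyl projection. -/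

section Algebra

variable {n : ℕ}

/-! Write S = T̊, t = t̄, and put the trace back with different weights: P = S + `metricProd t`,
that is P_{ijk} = S_{ijk} + g_{ij} t_k + g_{jk} t_i + g_{ki} t_j, totally symmetric with trace (n+2)
t. In terms of P both families of equations take a simple form.

The polynomial equations say that the symmetric matrices P_i = (P_{ikl})_{kl} satisfy [P_i,
P_j]_{kl} = -λ (g_{ik} g_{jl} - g_{jk} g_{il}), where n(n-1) λ = |S|² - (n-1)(n+2)|t|²
(`metricProd_curvature`). With R = n(n-1)κ the claim is therefore λ = 9κ. The derivative equations
combine into ∇_l P_{ijk} = 1/9 (P_{ij}·P_{kl} + P_{jk}·P_{il} + P_{ki}·P_{jl}) + μ (g_{ij} g_{kl} +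
g_{jk} g_{il} + g_{ki} g_{jl}) with μ = 5λ/18 + 3κ/2 (`rhsRing_add_metricProd`).

Differentiating the commutator identity along e_m and reducing the resulting cubic terms with the
identity itself (`quadDeriv_curvature`) shows that (λ - 9κ) times the Kulkarni-Nomizu product of P_m
with g equals 6 (∂_m λ) (g_{ik} g_{jl} - g_{jk} g_{il}). Since P is totally symmetric and n ≥ 3,
this forces (λ - 9κ) P = 0 (`mul_eq_zero_of_kulkarni`).

If λ ≠ 9κ at a point, then P = 0 nearby, so S and t vanish there and λ = 0; the formula for t̄_{k,l}
then leaves only its scalar curvature term, so κ = 0, a contradiction. -/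

theorem gg_comm (i j : Fin n) : gg i j = gg j i := by
  simp [gg, eq_comm]

theorem gg_self (i : Fin n) : gg i i = 1 := by simp [gg]

theorem sum_gg_self : ∑ a : Fin n, gg a a = n := by simp [gg]

theorem gg_dotProduct (i : Fin n) (u : Fin n → ℝ) : gg i ⬝ᵥ u = u i := by
  simp [dotProduct, gg]

theorem dotProduct_gg (i : Fin n) (u : Fin n → ℝ) : u ⬝ᵥ gg i = u i := by
  simp [dotProduct, gg]

theorem sum_mul_gg (f : Fin n → ℝ) (k : Fin n) : ∑ a, f a * gg a k = f k := by
  simp [gg]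

theorem sum_mul_gg' (f : Fin n → ℝ) (k : Fin n) : ∑ a, f a * gg k a = f k := by
  simp [gg]

/-- A tensor of valence three is totally symmetric. -/
def Symmetric3 (S : Fin n → Fin n → Fin n → ℝ) : Prop :=
  (∀ i j, S i j = S j i) ∧ ∀ i j k, S i j k = S i k j

/-- The symmetric product of the metric with a covector, without normalisation. -/
def metricProd (t : Fin n → ℝ) : Fin n → Fin n → Fin n → ℝ :=
  fun i j k => gg i j * t k + gg j k * t i + gg k i * t j

theorem metricProd_symmetric3 (t : Fin n → ℝ) : Symmetric3 (metricProd t) := by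
  constructor
  · intro i j
    funext k
    simp only [metricProd, gg_comm j i, gg_comm i k, gg_comm j k]
    ring
  · intro i j k
    simp only [metricProd, gg_comm j i, gg_comm i k, gg_comm j k]
    ring

theorem Symmetric3.add {A B : Fin n → Fin n → Fin n → ℝ} (hA : Symmetric3 A)
    (hB : Symmetric3 B) : Symmetric3 (A + B) := by
  constructor
  · intro i j
    simp only [Pi.add_apply, hA.1 i j, hB.1 i j]
  · intro i j k
    simp only [Pi.add_apply, hA.2 i j k, hB.2 i j k]

theorem sum_metricProd (t : Fin n → ℝ) (k : Fin n) :
    ∑ a, metricProd t a a k = ((n : ℝ) + 2) * t k := by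
  have h : ∀ a, metricProd t a a k = gg a a * t k + t a * gg a k + t a * gg a k := by
    intro a
    simp only [metricProd, gg_comm k a]
    ring
  simp only [h, Finset.sum_add_distrib, sum_mul_gg, ← Finset.sum_mul, sum_gg_self]
  ring

theorem add_metricProd_apply (S : Fin n → Fin n → Fin n → ℝ) (t : Fin n → ℝ) (i j : Fin n) :
    (S + metricProd t) i j = S i j + (gg i j • t + t i • gg j + t j • gg i) := by
  funext k
  simp only [Pi.add_apply, metricProd, Pi.smul_apply, smul_eq_mul, gg_comm k i]
  ring

/-- The contraction `P_{ik}^a P_{jla}` after adding the symmetric product of the metric and a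
covector. -/
theorem dotProduct_add_metricProd (S : Fin n → Fin n → Fin n → ℝ) (t : Fin n → ℝ) (i k j l : Fin n) :
    (S + metricProd t) i k ⬝ᵥ (S + metricProd t) j l
      = S i k ⬝ᵥ S j l + gg j l * contr S t i k + gg i k * contr S t j l
        + S i k j * t l + S i k l * t j + S j l i * t k + S j l k * t i
        + gg i k * gg j l * sq1 t + 2 * gg i k * t j * t l + 2 * gg j l * t i * t k
        + gg i j * t k * t l + gg i l * t k * t j + gg k j * t i * t l + gg k l * t i * t j := by
  have h1 : ∀ i j, S i j ⬝ᵥ t = contr S t i j := fun _ _ => rfl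
  have h2 : ∀ i j, t ⬝ᵥ S i j = contr S t i j := fun i j => dotProduct_comm _ _
  have h3 : t ⬝ᵥ t = sq1 t := rfl
  simp only [add_metricProd_apply, add_dotProduct, dotProduct_add, smul_dotProduct,
    dotProduct_smul, smul_eq_mul, h1, h2, h3, gg_dotProduct, dotProduct_gg]
  ring

/-- The Kulkarni-Nomizu product of a symmetric tensor with the metric. -/
def kulkarni (h : Fin n → Fin n → ℝ) : Fin n → Fin n → Fin n → Fin n → ℝ :=
  fun i j k l => h i k * gg j l + h j l * gg i k - h i l * gg j k - h j k * gg i l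

theorem ricci_kulkarni (h : Fin n → Fin n → ℝ) (i j : Fin n) :
    ricci (kulkarni h) i j = ((n : ℝ) - 2) * h i j + (∑ a, h a a) * gg i j := by
  have e : ∀ a, kulkarni h a i a j
      = h a a * gg i j + h i j * gg a a - h a j * gg a i - h i a * gg a j := by
    intro a
    simp only [kulkarni, gg_comm i a]
  simp only [ricci, e, Finset.sum_add_distrib, Finset.sum_sub_distrib, ← Finset.mul_sum,
    ← Finset.sum_mul, sum_gg_self, sum_mul_gg]
  ring

theorem scal_eq_sum_ricci (C : Fin n → Fin n → Fin n → Fin n → ℝ) :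
    scal C = ∑ b, ricci C b b := by
  simp only [scal, ricci]
  exact Finset.sum_comm

theorem scal_kulkarni (h : Fin n → Fin n → ℝ) :
    scal (kulkarni h) = 2 * ((n : ℝ) - 1) * ∑ a, h a a := by
  simp only [scal_eq_sum_ricci, ricci_kulkarni, Finset.sum_add_distrib, ← Finset.mul_sum,
    sum_gg_self]
  ring

theorem weyl_kulkarni (hn : 3 ≤ n) (h : Fin n → Fin n → ℝ) : weyl (kulkarni h) = 0 := by
  have hn' : (3 : ℝ) ≤ n := by exact_mod_cast hn
  have h1 : (n : ℝ) - 1 ≠ 0 := by linarith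
  have h2 : (n : ℝ) - 2 ≠ 0 := by linarith
  funext i j k l
  simp only [weyl, ricci_kulkarni, scal_kulkarni, kulkarni, Pi.zero_apply]
  field_simp
  ring

theorem weyl_add (C D : Fin n → Fin n → Fin n → Fin n → ℝ) : weyl (C + D) = weyl C + weyl D := by
  funext i j k l
  simp only [weyl, ricci, scal, Pi.add_apply, Finset.sum_add_distrib]
  ring

theorem weyl_smul (c : ℝ) (C : Fin n → Fin n → Fin n → Fin n → ℝ) :
    weyl (c • C) = c • weyl C := by
  funext i j k l
  simp only [weyl, ricci, scal, Pi.smul_apply, smul_eq_mul, ← Finset.mul_sum]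
  ring

end Algebra

/-! ### Trace decomposition of a structure tensor and the Weyl equation. -/

section StructureTensor

variable {n : ℕ}

theorem symm3_symmetric3 (A : Fin n → Fin n → Fin n → ℝ) : Symmetric3 (symm3 A) := by
  constructor
  · intro i j
    funext k
    simp only [symm3]
    ring
  · intro i j k
    simp only [symm3]
    ring

theorem traceFree3_eq (A : Fin n → Fin n → Fin n → ℝ) :
    traceFree3 A = A - (1 / ((n : ℝ) + 2)) • metricProd (fun k => ∑ a, A a a k) := by
  funext i j k
  simp only [traceFree3, metricProd, Pi.sub_apply, Pi.smul_apply, smul_eq_mul]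

theorem sum_traceFree3 (A : Fin n → Fin n → Fin n → ℝ) (k : Fin n) :
    ∑ a, traceFree3 A a a k = 0 := by
  have h : (n : ℝ) + 2 ≠ 0 := by positivity
  simp only [traceFree3_eq, Pi.sub_apply, Pi.smul_apply, smul_eq_mul, Finset.sum_sub_distrib,
    ← Finset.mul_sum, sum_metricProd]
  field_simp
  ring

theorem Symmetric3.smul {A : Fin n → Fin n → Fin n → ℝ} (hA : Symmetric3 A) (c : ℝ) :
    Symmetric3 (c • A) := by
  constructor
  · intro i j
    simp only [Pi.smul_apply, hA.1 i j]
  · intro i j k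
    simp only [Pi.smul_apply, hA.2 i j k]

theorem Symmetric3.sub {A B : Fin n → Fin n → Fin n → ℝ} (hA : Symmetric3 A)
    (hB : Symmetric3 B) : Symmetric3 (A - B) := by
  constructor
  · intro i j
    simp only [Pi.sub_apply, hA.1 i j, hB.1 i j]
  · intro i j k
    simp only [Pi.sub_apply, hA.2 i j k, hB.2 i j k]

theorem traceFree3_symmetric3 {A : Fin n → Fin n → Fin n → ℝ} (hA : Symmetric3 A) :
    Symmetric3 (traceFree3 A) := by
  rw [traceFree3_eq]
  exact hA.sub ((metricProd_symmetric3 _).smul _)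

theorem ring3_eq (T : Fin n → Fin n → Fin n → ℝ) :
    ring3 T = (1 / 6 : ℝ) • traceFree3 (symm3 T) := rfl

theorem ring3_symmetric3 (T : Fin n → Fin n → Fin n → ℝ) : Symmetric3 (ring3 T) := by
  rw [ring3_eq]
  exact (traceFree3_symmetric3 (symm3_symmetric3 T)).smul _

theorem sum_ring3 (T : Fin n → Fin n → Fin n → ℝ) (k : Fin n) : ∑ a, ring3 T a a k = 0 := by
  simp only [ring3_eq, Pi.smul_apply, ← Finset.smul_sum, sum_traceFree3, smul_zero]

/-- The decomposition of a structure tensor into its trace-free part and its trace. -/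
theorem structureTensor_eq (hn : 3 ≤ n) {T : Fin n → Fin n → Fin n → ℝ}
    (h1 : ∀ i j k, T j i k = T i j k) (h2 : ∀ k, ∑ i, T i i k = 0)
    (h3 : ∀ i j k, T i j k + 1 / ((n : ℝ) - 1) * gg i j * tr T k
      = T i k j + 1 / ((n : ℝ) - 1) * gg i k * tr T j) (i j k : Fin n) :
    T i j k = ring3 T i j k + tbar T i * gg j k + tbar T j * gg i k
      - 2 / (n : ℝ) * gg i j * tbar T k := by
  have hn' : (3 : ℝ) ≤ n := by exact_mod_cast hn
  have n0 : (n : ℝ) ≠ 0 := by linarith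
  have n1 : (n : ℝ) - 1 ≠ 0 := by linarith
  have n2 : (n : ℝ) + 2 ≠ 0 := by linarith
  have hs : ∀ k, ∑ a, symm3 T a a k = 4 * tr T k := by
    intro k
    have e : ∀ a, symm3 T a a k = 2 * T a a k + 4 * T a k a := by
      intro a
      simp only [symm3, h1 a k a]
      ring
    simp only [e, Finset.sum_add_distrib, ← Finset.mul_sum, h2, tr]
    ring
  have ht : ∀ k, tbar T k = (n : ℝ) / (((n : ℝ) + 2) * ((n : ℝ) - 1)) * tr T k := by
    intro k
    simp only [tbar, tr, fun a => h1 a k a]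
  rw [ring3_eq, traceFree3_eq]
  simp only [Pi.smul_apply, Pi.sub_apply, smul_eq_mul, metricProd, hs, ht]
  simp only [symm3]
  have e1 := h3 i j k
  have e2 := h3 j i k
  rw [h1 i j k, h1 j k i] at *
  rw [h1 i k j]
  rw [gg_comm j i] at e2
  rw [gg_comm k i]
  -- The linear condition reduces the remaining index orders of T to T i j k plus trace terms.
  rw [show T i k j = T i j k + 1 / ((n : ℝ) - 1) * gg i j * tr T k
      - 1 / ((n : ℝ) - 1) * gg i k * tr T j by linear_combination -e1,
    show T j k i = T i j k + 1 / ((n : ℝ) - 1) * gg i j * tr T k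
      - 1 / ((n : ℝ) - 1) * gg j k * tr T i by linear_combination -e2]
  field_simp
  ring

/-- After the Young operator, every term containing t is a Kulkarni-Nomizu product with g, which the
Weyl projection kills. -/
theorem weyl_dotProduct_eq_zero (hn : 3 ≤ n) {T S : Fin n → Fin n → Fin n → ℝ} {t : Fin n → ℝ}
    (hS : Symmetric3 S)
    (hT : ∀ i j k, T i j k = S i j k + t i * gg j k + t j * gg i k - 2 / (n : ℝ) * gg i j * t k)
    (hW : ∀ i j k l, weyl (youngWindow fun i j k l => ∑ a, T a i k * T a j l) i j k l = 0)
    (i j k l : Fin n) :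
    weyl (fun i j k l => S i k ⬝ᵥ S j l - S i l ⬝ᵥ S j k) i j k l = 0 := by
  have n0 : (n : ℝ) ≠ 0 := by positivity
  have hv : ∀ i k, (fun a => T a i k)
      = S i k + gg i k • t + t i • gg k - (2 / (n : ℝ) * t k) • gg i := by
    intro i k
    funext a
    simp only [hT, Pi.add_apply, Pi.sub_apply, Pi.smul_apply, smul_eq_mul]
    rw [hS.1 a i, hS.2 i a k, gg_comm k a, gg_comm i a]
    ring
  have hX : (fun i j k l => ∑ a, T a i k * T a j l)
      = fun i j k l => (fun a => T a i k) ⬝ᵥ (fun a => T a j l) := rfl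
  have k1 : ∀ i j, S i j ⬝ᵥ t = contr S t i j := fun _ _ => rfl
  have k2 : ∀ i j, t ⬝ᵥ S i j = contr S t i j := fun i j => dotProduct_comm _ _
  have k3 : t ⬝ᵥ t = sq1 t := rfl
  -- Symmetrising in (i,k) averages t_i g_k - (2/n) t_k g_i to α (t_i g_k + t_k g_i) with α = 1/2 -
  -- 1/n. The four symmetrised copies, doubled by the antisymmetrisation, give the factor 8; the
  -- cross terms with g t and the squares contribute 2α - α² to the coefficient of t ⊗ t.
  have key : youngWindow (fun i j k l => ∑ a, T a i k * T a j l)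
      = (8 : ℝ) • (fun i j k l => S i k ⬝ᵥ S j l - S i l ⬝ᵥ S j k)
        + kulkarni (fun i k => 8 * contr S t i k + 4 * sq1 t * gg i k
            + 8 * (2 * (1 / 2 - 1 / (n : ℝ)) - (1 / 2 - 1 / (n : ℝ)) ^ 2) * t i * t k) := by
    rw [hX]
    funext i j k l
    have c1 : contr S t k i = contr S t i k := by simp only [contr, hS.1 k i]
    have c2 : contr S t l j = contr S t j l := by simp only [contr, hS.1 l j]
    have c3 : contr S t l i = contr S t i l := by simp only [contr, hS.1 l i]
    have c4 : contr S t k j = contr S t j k := by simp only [contr, hS.1 k j]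
    simp only [youngWindow, hv, Pi.add_apply, Pi.smul_apply, smul_eq_mul, kulkarni,
      add_dotProduct, dotProduct_add, sub_dotProduct, dotProduct_sub, smul_dotProduct,
      dotProduct_smul, k1, k2, k3, gg_dotProduct, dotProduct_gg]
    rw [hS.1 k i, hS.1 l j, hS.1 l i, hS.1 k j, c1, c2, c3, c4, gg_comm k i, gg_comm l j,
      gg_comm l i, gg_comm k j, gg_comm l k, gg_comm j i, dotProduct_comm (S j l) (S i k),
      dotProduct_comm (S j k) (S i l), hS.2 j l i, hS.1 j i, hS.2 i l j, hS.2 j k i, hS.1 j i,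
      hS.2 i k j, hS.2 i l k, hS.2 j l k]
    field_simp
    ring
  have hn8 := hW i j k l
  rw [key, weyl_add, weyl_smul, weyl_kulkarni hn] at hn8
  simpa using hn8

theorem sum_sq2 (S : Fin n → Fin n → Fin n → ℝ) : ∑ a, sq2 S a a = sq3 S := rfl

/-- A curvature tensor without Weyl part is determined by its Ricci contraction. Here that
contraction is -S_i^{ab} S_{jab}, because the other term contains the trace of S. -/
theorem dotProduct_sub_dotProduct {S : Fin n → Fin n → Fin n → ℝ}
    (hS : Symmetric3 S) (hS0 : ∀ k, ∑ a, S a a k = 0)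
    (hW : ∀ i j k l, weyl (fun i j k l => S i k ⬝ᵥ S j l - S i l ⬝ᵥ S j k) i j k l = 0)
    (i j k l : Fin n) :
    S i k ⬝ᵥ S j l - S i l ⬝ᵥ S j k
      = - (1 / ((n : ℝ) - 2)) * (sq2 S i k * gg j l + sq2 S j l * gg i k
          - sq2 S i l * gg j k - sq2 S j k * gg i l)
        + sq3 S / (((n : ℝ) - 1) * ((n : ℝ) - 2)) * (gg i k * gg j l - gg i l * gg j k) := by
  have hv : ∑ a, S a a = 0 := by
    funext k
    simpa using hS0 k
  have hr : ∀ i j, ricci (fun i j k l => S i k ⬝ᵥ S j l - S i l ⬝ᵥ S j k) i j = - sq2 S i j := by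
    intro i j
    have e : ∀ a, S a j ⬝ᵥ S i a = ∑ b, S i a b * S j a b := by
      intro a
      rw [dotProduct_comm, hS.1 a j]
      rfl
    simp only [ricci, Finset.sum_sub_distrib, ← sum_dotProduct, hv, zero_dotProduct, e, sq2]
    ring
  have hsc : scal (fun i j k l => S i k ⬝ᵥ S j l - S i l ⬝ᵥ S j k) = - sq3 S := by
    simp only [scal_eq_sum_ricci, hr, Finset.sum_neg_distrib, sum_sq2]
  have h := hW i j k l
  simp only [weyl, hr, hsc] at h
  linear_combination h

end StructureTensor

/-! ### Rewriting the equations in terms of P = S + `metricProd t`. -/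

section DerivativeFormulas

variable {n : ℕ}

theorem sum_contr_self {S : Fin n → Fin n → Fin n → ℝ} (hS0 : ∀ k, ∑ a, S a a k = 0)
    (t : Fin n → ℝ) : ∑ a, contr S t a a = 0 := by
  simp only [contr]
  rw [Finset.sum_comm]
  simp only [← Finset.sum_mul, hS0, zero_mul, Finset.sum_const_zero]

/-- Here κ is the Ricci factor, not the sectional curvature; as a multiple of g it drops out of the
trace-free part. -/
theorem sq2_eq (hn : 3 ≤ n) {S : Fin n → Fin n → Fin n → ℝ}
    (hS0 : ∀ k, ∑ a, S a a k = 0) {t : Fin n → ℝ} {κ : ℝ} {Z : Fin n → Fin n → ℝ}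
    (hZ : ∀ i j, Z i j = sq2 S i j - ((n : ℝ) - 2) * (contr S t i j + t i * t j) - κ * gg i j)
    (h0 : ∀ i j, traceFree2 Z i j = 0) (i j : Fin n) :
    sq2 S i j = ((n : ℝ) - 2) * (contr S t i j + t i * t j)
      + (sq3 S - ((n : ℝ) - 2) * sq1 t) / n * gg i j := by
  have hn' : (3 : ℝ) ≤ n := by exact_mod_cast hn
  have n0 : (n : ℝ) ≠ 0 := by linarith
  have hs : ∑ a, Z a a = sq3 S - ((n : ℝ) - 2) * sq1 t - κ * n := by
    simp only [hZ, Finset.sum_sub_distrib, ← Finset.mul_sum, Finset.sum_add_distrib, sum_sq2,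
      sum_contr_self hS0, sum_gg_self, sq1, zero_add]
  have h := h0 i j
  simp only [traceFree2, hs] at h
  rw [hZ] at h
  field_simp at h ⊢
  linear_combination h

/-- The constant `λ` in the curvature-like equation for `P = S + metricProd t`. -/
def lam (S : Fin n → Fin n → Fin n → ℝ) (t : Fin n → ℝ) : ℝ :=
  (sq3 S - ((n : ℝ) - 1) * ((n : ℝ) + 2) * sq1 t) / ((n : ℝ) * ((n : ℝ) - 1))

/-- The t-terms of P·P contribute the Kulkarni-Nomizu product of `contr S t` + t ⊗ t with g. By `hQ`
this cancels the `sq2` terms up to multiples of g, so only a constant-curvature expression is left.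
-/
theorem metricProd_curvature (hn : 3 ≤ n) {S : Fin n → Fin n → Fin n → ℝ} (hS : Symmetric3 S)
    {t : Fin n → ℝ}
    (hC : ∀ i j k l, S i k ⬝ᵥ S j l - S i l ⬝ᵥ S j k
      = - (1 / ((n : ℝ) - 2)) * (sq2 S i k * gg j l + sq2 S j l * gg i k
          - sq2 S i l * gg j k - sq2 S j k * gg i l)
        + sq3 S / (((n : ℝ) - 1) * ((n : ℝ) - 2)) * (gg i k * gg j l - gg i l * gg j k))
    (hQ : ∀ i j, sq2 S i j = ((n : ℝ) - 2) * (contr S t i j + t i * t j)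
      + (sq3 S - ((n : ℝ) - 2) * sq1 t) / n * gg i j) (i j k l : Fin n) :
    (S + metricProd t) i k ⬝ᵥ (S + metricProd t) j l
        - (S + metricProd t) j k ⬝ᵥ (S + metricProd t) i l
      = - lam S t * (gg i k * gg j l - gg j k * gg i l) := by
  have hn' : (3 : ℝ) ≤ n := by exact_mod_cast hn
  have n0 : (n : ℝ) ≠ 0 := by linarith
  have n1 : (n : ℝ) - 1 ≠ 0 := by linarith
  have n2 : (n : ℝ) - 2 ≠ 0 := by linarith
  simp only [dotProduct_add_metricProd, lam]
  have h := hC i j k l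
  simp only [hQ] at h
  rw [dotProduct_comm (S j k) (S i l), show S i k ⬝ᵥ S j l = S i l ⬝ᵥ S j k
    + (S i k ⬝ᵥ S j l - S i l ⬝ᵥ S j k) by ring, h]
  rw [hS.2 j l i, hS.1 j i, hS.2 i l j, hS.2 j k i, hS.1 j i, hS.2 i k j, hS.2 i l k, hS.2 j l k,
    gg_comm j i, gg_comm k j, gg_comm k i]
  field_simp
  ring

/-- Eliminating `sq2` leaves `contr S t` + 2 t ⊗ t up to multiples of g, which is P_{kl}·t up to
multiples of g. -/
theorem rhsTbar_eq (hn : 3 ≤ n) {S : Fin n → Fin n → Fin n → ℝ}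
    (hS0 : ∀ k, ∑ a, S a a k = 0) {t : Fin n → ℝ}
    (hQ : ∀ i j, sq2 S i j = ((n : ℝ) - 2) * (contr S t i j + t i * t j)
      + (sq3 S - ((n : ℝ) - 2) * sq1 t) / n * gg i j) (κ : ℝ) (k l : Fin n) :
    rhsTbar S t ((n : ℝ) * ((n : ℝ) - 1) * κ) k l
      = 1 / 3 * ((S + metricProd t) k l ⬝ᵥ t)
        + ((3 * (n : ℝ) + 2) / (6 * ((n : ℝ) + 2)) * lam S t + 3 / 2 * κ) * gg k l := by
  have hn' : (3 : ℝ) ≤ n := by exact_mod_cast hn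
  have n0 : (n : ℝ) ≠ 0 := by linarith
  have n1 : (n : ℝ) - 1 ≠ 0 := by linarith
  have n2 : (n : ℝ) - 2 ≠ 0 := by linarith
  have n3 : (n : ℝ) + 2 ≠ 0 := by linarith
  have hs : ∑ a, (-(2 / ((n : ℝ) - 2)) * sq2 S a a + 3 * contr S t a a + 4 * t a * t a)
      = -(2 / ((n : ℝ) - 2)) * sq3 S + 4 * sq1 t := by
    simp only [Finset.sum_add_distrib, ← Finset.mul_sum, sum_sq2, sum_contr_self hS0, sq1,
      mul_assoc, mul_zero, add_zero]
  have k1 : S k l ⬝ᵥ t = contr S t k l := rfl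
  have k3 : t ⬝ᵥ t = sq1 t := rfl
  simp only [rhsTbar, traceFree2, hs, add_metricProd_apply, add_dotProduct, smul_dotProduct,
    smul_eq_mul, k1, k3, gg_dotProduct, lam]
  rw [hQ]
  field_simp
  ring

/-- The bracket in the formula for T̊_{ijk,l} and the quadratic expression in P agree modulo pure
trace. The explicit trace vector on the right is immaterial later; only its existence matters. -/
theorem symm3_sub_eq (hn : 3 ≤ n) {S : Fin n → Fin n → Fin n → ℝ} (hS : Symmetric3 S)
    {t : Fin n → ℝ}
    (hQ : ∀ i j, sq2 S i j = ((n : ℝ) - 2) * (contr S t i j + t i * t j)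
      + (sq3 S - ((n : ℝ) - 2) * sq1 t) / n * gg i j) (μ : ℝ) (i j k l : Fin n) :
    1 / 9 * ((S + metricProd t) i j ⬝ᵥ (S + metricProd t) k l
        + (S + metricProd t) j k ⬝ᵥ (S + metricProd t) i l
        + (S + metricProd t) k i ⬝ᵥ (S + metricProd t) j l) + μ * metricProd (fun k => gg k l) i j k
      - 1 / 18 * symm3 (fun i j k =>
      (∑ a, S i j a * S k l a) + S i j k * t l + 3 * S i j l * t k
        + (4 / ((n : ℝ) - 2) * sq2 S i j - 3 * contr S t i j) * gg k l) i j k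
      = metricProd (fun k => 1 / 9 * (contr S t k l + 4 * t k * t l
          + (sq1 t - 4 / ((n : ℝ) - 2) * ((sq3 S - ((n : ℝ) - 2) * sq1 t) / n)) * gg k l)
          + μ * gg k l) i j k := by
  have hn' : (3 : ℝ) ≤ n := by exact_mod_cast hn
  have n0 : (n : ℝ) ≠ 0 := by linarith
  have n2 : (n : ℝ) - 2 ≠ 0 := by linarith
  have k0 : ∀ i j k l, ∑ a, S i j a * S k l a = S i j ⬝ᵥ S k l := fun _ _ _ _ => rfl
  have c : ∀ i j, contr S t i j = contr S t j i := fun i j => by simp only [contr, hS.1 i j]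
  simp only [dotProduct_add_metricProd, symm3, metricProd, hQ, k0]
  rw [hS.1 j i, hS.1 k i, hS.1 k j, c j i, c k i, c k j, hS.2 i k j, hS.2 j k i, hS.1 j i,
    hS.2 i l j, hS.2 i l k, hS.2 j l i, hS.2 j l k, hS.2 k l i, hS.2 k l j, hS.1 j i, hS.1 k i,
    hS.1 k j, gg_comm j i, gg_comm k i, gg_comm k j]
  field_simp
  ring

end DerivativeFormulas

/-! ### The closed derivative formula for P and its integrability consequence. -/

section Prolongation

variable {n : ℕ}

/-- N and B have the same trace-free part, and N is recovered from that part together with its own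
trace; the trace of B need not be computed. -/
theorem traceFree3_add_metricProd {N B : Fin n → Fin n → Fin n → ℝ} {h d : Fin n → ℝ}
    (hNB : N - B = metricProd h) (hN : ∀ k, ∑ a, N a a k = ((n : ℝ) + 2) * d k) :
    traceFree3 B + metricProd d = N := by
  have h2 : (n : ℝ) + 2 ≠ 0 := by positivity
  have hB : B = N - metricProd h := by rw [← hNB, sub_sub_cancel]
  rw [traceFree3_eq]
  funext i j k
  simp only [hB, Pi.sub_apply, Pi.add_apply, Pi.smul_apply, smul_eq_mul,
    Finset.sum_sub_distrib, hN, sum_metricProd]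
  simp only [metricProd]
  field_simp
  ring

theorem sum_add_metricProd {S : Fin n → Fin n → Fin n → ℝ} (hS0 : ∀ k, ∑ a, S a a k = 0)
    (t : Fin n → ℝ) : ∑ a, (S + metricProd t) a a = ((n : ℝ) + 2) • t := by
  funext k
  simp [Finset.sum_add_distrib, hS0, sum_metricProd]

/-- The first derivative `P_{ijk,l}` as a quadratic expression in `P`. -/
def quadDeriv (P : Fin n → Fin n → Fin n → ℝ) (μ : ℝ) (l i j k : Fin n) : ℝ :=
  1 / 9 * (P i j ⬝ᵥ P k l + P j k ⬝ᵥ P i l + P k i ⬝ᵥ P j l) + μ * metricProd (gg l) i j k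

/-- The curvature-like identity turns each P_{ak}·P_{al} into P_{aa}·P_{kl} plus metric terms, so
all three quadratic terms contract to P_{kl}·t. -/
theorem sum_quadDeriv {P : Fin n → Fin n → Fin n → ℝ} (hP : Symmetric3 P) {t : Fin n → ℝ}
    (hPt : ∑ a, P a a = ((n : ℝ) + 2) • t) {L : ℝ}
    (hC : ∀ i j k l, P i k ⬝ᵥ P j l - P j k ⬝ᵥ P i l = - L * (gg i k * gg j l - gg j k * gg i l))
    (μ : ℝ) (l k : Fin n) :
    ∑ a, quadDeriv P μ l a a k = ((n : ℝ) + 2) * (1 / 3 * (P k l ⬝ᵥ t))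
      + (2 / 9 * ((n : ℝ) - 1) * L + μ * ((n : ℝ) + 2)) * gg k l := by
  have e : ∀ a, P a k ⬝ᵥ P a l = P a a ⬝ᵥ P k l + L * (gg a a * gg k l - gg k a * gg a l) := by
    intro a
    have h := hC k a a l
    rw [hP.1 k a] at h
    linear_combination h
  have e' : ∀ a, quadDeriv P μ l a a k = 1 / 3 * (P a a ⬝ᵥ P k l)
      + 2 / 9 * L * (gg a a * gg k l - gg k a * gg a l) + μ * metricProd (gg l) a a k := by
    intro a
    simp only [quadDeriv, hP.1 k a, e]
    ring
  simp only [e', Finset.sum_add_distrib, ← Finset.mul_sum, Finset.sum_sub_distrib, ← sum_dotProduct,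
    hPt, sum_mul_gg, ← Finset.sum_mul, sum_gg_self, sum_metricProd, smul_dotProduct, smul_eq_mul]
  rw [dotProduct_comm, gg_comm l k]
  ring

theorem rhsRing_add_metricProd (hn : 3 ≤ n) {S : Fin n → Fin n → Fin n → ℝ} (hS : Symmetric3 S)
    (hS0 : ∀ k, ∑ a, S a a k = 0) {t : Fin n → ℝ}
    (hQ : ∀ i j, sq2 S i j = ((n : ℝ) - 2) * (contr S t i j + t i * t j)
      + (sq3 S - ((n : ℝ) - 2) * sq1 t) / n * gg i j)
    (hC : ∀ i j k l, (S + metricProd t) i k ⬝ᵥ (S + metricProd t) j l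
        - (S + metricProd t) j k ⬝ᵥ (S + metricProd t) i l
      = - lam S t * (gg i k * gg j l - gg j k * gg i l)) (κ : ℝ) (i j k l : Fin n) :
    rhsRing S t i j k l
        + metricProd (fun k => rhsTbar S t ((n : ℝ) * ((n : ℝ) - 1) * κ) k l) i j k
      = quadDeriv (S + metricProd t) (5 / 18 * lam S t + 3 / 2 * κ) l i j k := by
  have n3 : (n : ℝ) + 2 ≠ 0 := by positivity
  -- The value 5/18 is forced by matching traces: 2(n-1)/9 + (5/18)(n+2) = (3n+2)/6.
  set μ : ℝ := 5 / 18 * lam S t + 3 / 2 * κ with hμ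
  set B : Fin n → Fin n → Fin n → ℝ := (1 / 18 : ℝ) • symm3 (fun i j k =>
      (∑ a, S i j a * S k l a) + S i j k * t l + 3 * S i j l * t k
        + (4 / ((n : ℝ) - 2) * sq2 S i j - 3 * contr S t i j) * gg k l) with hB
  have hr : rhsRing S t i j k l = traceFree3 B i j k := by
    simp only [hB, rhsRing, symm3Free, traceFree3_eq, Pi.sub_apply, Pi.smul_apply, smul_eq_mul,
      metricProd, ← Finset.mul_sum]
    ring
  have hgl : (fun k => gg k l) = (gg l : Fin n → ℝ) := by
    funext k
    exact gg_comm k l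
  have h1 : quadDeriv (S + metricProd t) μ l - B
      = metricProd (fun k => 1 / 9 * (contr S t k l + 4 * t k * t l
          + (sq1 t - 4 / ((n : ℝ) - 2) * ((sq3 S - ((n : ℝ) - 2) * sq1 t) / n)) * gg k l)
          + μ * gg k l) := by
    funext i j k
    rw [← symm3_sub_eq hn hS hQ μ i j k l, hgl]
    rfl
  have h2 : ∀ k, ∑ a, quadDeriv (S + metricProd t) μ l a a k
      = ((n : ℝ) + 2) * rhsTbar S t ((n : ℝ) * ((n : ℝ) - 1) * κ) k l := by
    intro k
    rw [sum_quadDeriv (hS.add (metricProd_symmetric3 t)) (sum_add_metricProd hS0 t) hC,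
      rhsTbar_eq hn hS0 hQ, hμ]
    field_simp
    ring
  rw [hr]
  exact congrFun (congrFun (congrFun (traceFree3_add_metricProd h1 h2) i) j) k

theorem sum_dotProduct_mul {P : Fin n → Fin n → Fin n → ℝ} (hP : Symmetric3 P) (i : Fin n)
    (u v : Fin n → ℝ) : ∑ a, (u ⬝ᵥ P i a) * v a = ∑ b, u b * (P i b ⬝ᵥ v) := by
  simp only [dotProduct, Finset.sum_mul, Finset.mul_sum]
  rw [Finset.sum_comm]
  refine Finset.sum_congr rfl fun b _ => Finset.sum_congr rfl fun a _ => ?_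
  rw [hP.2 i a b, mul_assoc]

/-- In matrix form this is P_i P_m P_j - P_j P_m P_i = [P_i, P_m] P_j + P_m [P_i, P_j] - [P_j, P_m]
P_i, with each commutator replaced by its metric value. -/
theorem cubic_sub_cubic {P : Fin n → Fin n → Fin n → ℝ} (hP : Symmetric3 P) {L : ℝ}
    (hC : ∀ i j k l, P i k ⬝ᵥ P j l - P j k ⬝ᵥ P i l = - L * (gg i k * gg j l - gg j k * gg i l))
    (i j k l m : Fin n) :
    (∑ a, (P i k ⬝ᵥ P m a) * P j l a) - ∑ a, (P j k ⬝ᵥ P m a) * P i l a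
      = - L * kulkarni (P m) i j k l := by
  have h1 : ∀ i j, ∑ a, (P i k ⬝ᵥ P m a) * P j l a
      = (∑ b, P m k b * (P i b ⬝ᵥ P j l)) - L * (gg i k * P j l m - gg m k * P j l i) := by
    intro i j
    have e : ∀ a, (P i k ⬝ᵥ P m a) * P j l a = (P m k ⬝ᵥ P i a) * P j l a
        - L * (gg i k * (P j l a * gg m a) - gg m k * (P j l a * gg i a)) := by
      intro a
      linear_combination P j l a * hC i m k a
    simp only [e, Finset.sum_sub_distrib, ← Finset.mul_sum, sum_mul_gg', sum_dotProduct_mul hP]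
  have e2 : ∀ b, P m k b * (P i b ⬝ᵥ P j l) = P m k b * (P j b ⬝ᵥ P i l)
      - L * (gg j l * (P m k b * gg i b) - gg i l * (P m k b * gg j b)) := by
    intro b
    linear_combination P m k b * hC i j b l
  have h2 : ∑ b, P m k b * (P i b ⬝ᵥ P j l) = ∑ b, P m k b * (P j b ⬝ᵥ P i l)
      - L * (gg j l * P m k i - gg i l * P m k j) := by
    simp only [e2, Finset.sum_sub_distrib, ← Finset.mul_sum, sum_mul_gg']
  have p1 : ∀ j l, P j l m = P m j l := fun j l => by rw [hP.2 j l m, hP.1 j m]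
  rw [h1 i j, h1 j i, h2, p1, p1, hP.2 m k i, hP.2 m k j, hP.2 j l i, hP.1 j i, hP.2 i j l]
  simp only [kulkarni]
  ring

/-- Differentiating the curvature-like equation with the first derivative `quadDeriv`. -/
theorem quadDeriv_curvature {P : Fin n → Fin n → Fin n → ℝ} (hP : Symmetric3 P) {L : ℝ}
    (hC : ∀ i j k l, P i k ⬝ᵥ P j l - P j k ⬝ᵥ P i l = - L * (gg i k * gg j l - gg j k * gg i l))
    (μ : ℝ) (i j k l m : Fin n) :
    quadDeriv P μ m i k ⬝ᵥ P j l + P i k ⬝ᵥ quadDeriv P μ m j l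
        - quadDeriv P μ m j k ⬝ᵥ P i l - P j k ⬝ᵥ quadDeriv P μ m i l
      = (μ - 4 / 9 * L) * kulkarni (P m) i j k l := by
  -- Modulo metric terms the three quadratic terms coincide, so the derivative is one third of a
  -- single matrix product.
  have hv : ∀ i k, quadDeriv P μ m i k = (1 / 3 : ℝ) • (fun a => P i k ⬝ᵥ P m a)
      + ((2 / 9 * L + μ) * gg i k) • gg m
      + ((μ - 1 / 9 * L) * gg i m) • gg k + ((μ - 1 / 9 * L) * gg k m) • gg i := by
    intro i k
    funext a
    have e1 := hC i a k m
    have e2 := hC k a i m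
    rw [hP.1 a k] at e1
    rw [hP.1 k i, hP.1 a i] at e2
    simp only [quadDeriv, metricProd, Pi.add_apply, Pi.smul_apply, smul_eq_mul]
    rw [hP.1 a i, hP.1 m a, gg_comm m a, gg_comm a i, gg_comm m k, gg_comm m i]
    rw [gg_comm a k] at e1
    rw [gg_comm k i, gg_comm a i] at e2
    linear_combination (-1 / 9) * e1 + (-1 / 9) * e2
  have hM : ∀ i k j l, (fun a => P i k ⬝ᵥ P m a) ⬝ᵥ P j l = ∑ a, (P i k ⬝ᵥ P m a) * P j l a :=
    fun _ _ _ _ => rfl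
  have hM' : ∀ i k j l, P i k ⬝ᵥ (fun a => P j l ⬝ᵥ P m a)
      = ∑ a, (P i k ⬝ᵥ P m a) * P j l a := by
    intro i k j l
    rw [sum_dotProduct_mul hP, dotProduct]
    refine Finset.sum_congr rfl fun a _ => ?_
    rw [dotProduct_comm (P j l)]
  have h := cubic_sub_cubic hP hC i j k l m
  simp only [hv, add_dotProduct, dotProduct_add, smul_dotProduct, dotProduct_smul, smul_eq_mul,
    gg_dotProduct, dotProduct_gg, hM, hM']
  have p1 : ∀ j l, P j l m = P m j l := fun j l => by rw [hP.2 j l m, hP.1 j m]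
  simp only [p1]
  simp only [kulkarni] at h ⊢
  rw [hP.2 j l i, hP.2 j l k, hP.1 j i, hP.2 i l j, hP.2 i l k, hP.2 j k i, hP.1 j i,
    hP.2 i k j]
  -- The g_{im}-type terms cancel under antisymmetrisation. The cubic terms give -2L/3 and the
  -- metric terms μ + 2L/9, in total μ - 4L/9.
  linear_combination (2 / 3) * h

theorem exists_ne_ne (hn : 3 ≤ n) (i k : Fin n) : ∃ j, j ≠ i ∧ j ≠ k := by
  have h : ({i, k} : Finset (Fin n)).card < Fintype.card (Fin n) := by
    rw [Fintype.card_fin]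
    exact lt_of_le_of_lt Finset.card_le_two (by omega)
  obtain ⟨j, hj⟩ := Finset.exists_mem_notMem_of_card_lt_card
    (s := ({i, k} : Finset (Fin n))) (t := Finset.univ) (by simpa using h)
  simp only [Finset.mem_insert, Finset.mem_singleton, not_or] at hj
  exact ⟨j, hj.2⟩

/-- A multiple of a totally symmetric tensor whose slices have Kulkarni-Nomizu products of constant
curvature type vanishes. -/
theorem mul_eq_zero_of_kulkarni (hn : 3 ≤ n) {P : Fin n → Fin n → Fin n → ℝ} (hP : Symmetric3 P)
    {D : ℝ} {c : Fin n → ℝ}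
    (h : ∀ m i j k l, D * kulkarni (P m) i j k l = c m * (gg i k * gg j l - gg j k * gg i l))
    (i j k : Fin n) : D * P i j k = 0 := by
  have off : ∀ m i k, i ≠ k → D * P m i k = 0 := by
    intro m i k hik
    obtain ⟨j, hji, hjk⟩ := exists_ne_ne hn i k
    have e := h m i j k j
    simp only [kulkarni, gg, if_neg hik, if_neg hjk, if_neg hji.symm, if_true] at e
    linear_combination e
  -- Off-diagonal entries vanish; for three distinct indices the pairwise sums of diagonal entries
  -- agree, so each diagonal entry is c m / 2.
  have diag2 : ∀ m i j, i ≠ j → D * P m i i + D * P m j j = c m := by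
    intro m i j hij
    have e := h m i j i j
    simp only [kulkarni, gg, if_neg hij, if_neg hij.symm, if_true] at e
    linear_combination e
  have diag : ∀ m i, D * P m i i = c m / 2 := by
    intro m i
    obtain ⟨j, hji, -⟩ := exists_ne_ne hn i i
    obtain ⟨k, hki, hkj⟩ := exists_ne_ne hn i j
    linear_combination (diag2 m i j hji.symm + diag2 m i k hki.symm - diag2 m j k hkj.symm) / 2
  -- Total symmetry makes the diagonal entry (m; i, i) with i ≠ m an off-diagonal entry of the slice
  -- i.
  have hc : ∀ m, c m = 0 := by
    intro m
    obtain ⟨i, him, -⟩ := exists_ne_ne hn m m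
    have e := off i i m him
    rw [hP.2 i i m, hP.1 i m, diag] at e
    linarith
  by_cases hjk : j = k
  · rw [hjk, diag, hc, zero_div]
  · exact off i j k hjk

end Prolongation

/-! ### Covariant and partial derivatives of the curvature-like identity. -/

section CovariantLeibniz

variable {n : ℕ}

theorem dotProduct_antisymm {w : Fin n → Fin n → ℝ} (hw : ∀ i j, w i j = - w j i)
    (u v : Fin n → ℝ) :
    (fun a => ∑ m, w a m * u m) ⬝ᵥ v + u ⬝ᵥ (fun a => ∑ m, w a m * v m) = 0 := by
  simp only [dotProduct, Finset.sum_mul, Finset.mul_sum]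
  rw [Finset.sum_comm, ← Finset.sum_add_distrib]
  refine Finset.sum_eq_zero fun a _ => ?_
  rw [← Finset.sum_add_distrib]
  refine Finset.sum_eq_zero fun m _ => ?_
  rw [hw m a]
  ring

/-- The Leibniz rule for the curvature-like equation: partial derivatives in an orthonormal frame
may be replaced by covariant derivatives. -/
theorem covariant_curvature {P dP DP : Fin n → Fin n → Fin n → ℝ} {w : Fin n → Fin n → ℝ}
    (hw : ∀ i j, w i j = - w j i)
    (hD : ∀ i j k, DP i j k = dP i j k
      - ∑ m, (w i m * P m j k + w j m * P i m k + w k m * P i j m)) {L : ℝ}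
    (hC : ∀ i j k l, P i k ⬝ᵥ P j l - P j k ⬝ᵥ P i l = - L * (gg i k * gg j l - gg j k * gg i l))
    (i j k l : Fin n) :
    DP i k ⬝ᵥ P j l + P i k ⬝ᵥ DP j l - DP j k ⬝ᵥ P i l - P j k ⬝ᵥ DP i l
      = dP i k ⬝ᵥ P j l + P i k ⬝ᵥ dP j l - dP j k ⬝ᵥ P i l - P j k ⬝ᵥ dP i l := by
  have hv : ∀ i j, DP i j = dP i j - ∑ m, w i m • P m j - ∑ m, w j m • P i m
      - fun a => ∑ m, w a m * P i j m := by
    intro i j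
    funext a
    simp only [hD, Finset.sum_add_distrib, Pi.sub_apply, Finset.sum_apply, Pi.smul_apply,
      smul_eq_mul]
    ring
  -- Rotating one free index by w acts on the metric expression alone; the contracted index is
  -- handled by `dotProduct_antisymm`.
  have hE : ∀ p (f : Fin n → ℝ) (g : Fin n → ℝ) (q r : Fin n) (a b : ℝ),
      (∀ m, f m - g m = - L * (gg m q * a - gg m r * b)) →
      ∑ m, w p m * f m - ∑ m, w p m * g m = - L * (w p q * a - w p r * b) := by
    intro p f g q r a b h
    have e : ∀ m, w p m * f m - w p m * g m
        = - L * a * (w p m * gg m q) + L * b * (w p m * gg m r) := by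
      intro m
      linear_combination w p m * h m
    rw [← Finset.sum_sub_distrib]
    simp only [e, Finset.sum_add_distrib, ← Finset.mul_sum, sum_mul_gg]
    ring
  have si := hE i (fun m => P m k ⬝ᵥ P j l) (fun m => P j k ⬝ᵥ P m l) k l (gg j l) (gg j k)
    (fun m => by linear_combination hC m j k l)
  have sj := hE j (fun m => P i k ⬝ᵥ P m l) (fun m => P m k ⬝ᵥ P i l) l k (gg i k) (gg i l)
    (fun m => by linear_combination hC i m k l)
  have sk := hE k (fun m => P i m ⬝ᵥ P j l) (fun m => P j m ⬝ᵥ P i l) i j (gg j l) (gg i l)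
    (fun m => by rw [gg_comm m i, gg_comm m j]; linear_combination hC i j m l)
  have sl := hE l (fun m => P i k ⬝ᵥ P j m) (fun m => P j k ⬝ᵥ P i m) j i (gg i k) (gg j k)
    (fun m => by rw [gg_comm m i, gg_comm m j]; linear_combination hC i j k m)
  have o1 := dotProduct_antisymm hw (P i k) (P j l)
  have o2 := dotProduct_antisymm hw (P j k) (P i l)
  simp only [hv, sub_dotProduct, dotProduct_sub, sum_dotProduct, dotProduct_sum, smul_dotProduct,
    dotProduct_smul, smul_eq_mul]
  -- The metric terms left from the four free indices cancel in pairs because w is antisymmetric.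
  linear_combination -si - sj - sk - sl - o1 + o2 + L * gg j l * hw i k
    - L * gg j k * hw i l + L * gg i k * hw j l - L * gg i l * hw j k

end CovariantLeibniz

/-! ### Directional derivatives and local orthonormal frames. -/

section Frames

variable {n : ℕ} {E : Type*} [NormedAddCommGroup E] [NormedSpace ℝ E]
  {M : Type*} [TopologicalSpace M] [ChartedSpace E M]

/-- `f` is differentiable at `x`, with derivative `c` in the direction `v`. -/
def HasDirDeriv (x : M) (v : TangentSpace 𝓘(ℝ, E) x) (f : M → ℝ) (c : ℝ) : Prop :=
  MDifferentiableAt 𝓘(ℝ, E) 𝓘(ℝ, ℝ) f x ∧ mvfderiv 𝓘(ℝ, E) f x v = c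

namespace HasDirDeriv

variable {x : M} {v : TangentSpace 𝓘(ℝ, E) x} {f g : M → ℝ} {c d : ℝ}

theorem const (x : M) (v : TangentSpace 𝓘(ℝ, E) x) (a : ℝ) :
    HasDirDeriv x v (fun _ => a) 0 :=
  ⟨mdifferentiableAt_const, by rw [mvfderiv_const]; rfl⟩

theorem add (hf : HasDirDeriv x v f c) (hg : HasDirDeriv x v g d) :
    HasDirDeriv x v (fun y => f y + g y) (c + d) :=
  ⟨hf.1.add hg.1, by
    rw [mvfderiv_fun_add hf.1 hg.1, add_apply, hf.2, hg.2]⟩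

theorem mul (hf : HasDirDeriv x v f c) (hg : HasDirDeriv x v g d) :
    HasDirDeriv x v (fun y => f y * g y) (c * g x + f x * d) :=
  ⟨hf.1.mul hg.1, by
    rw [mvfderiv_fun_mul hf.1 hg.1]
    simp only [add_apply, smul_apply, smul_eq_mul, hf.2,
      hg.2]
    ring⟩

theorem const_mul (a : ℝ) (hf : HasDirDeriv x v f c) :
    HasDirDeriv x v (fun y => a * f y) (a * c) := by
  simpa using (const x v a).mul hf

theorem mul_const (hf : HasDirDeriv x v f c) (a : ℝ) :
    HasDirDeriv x v (fun y => f y * a) (c * a) := by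
  simpa using hf.mul (const x v a)

theorem sub (hf : HasDirDeriv x v f c) (hg : HasDirDeriv x v g d) :
    HasDirDeriv x v (fun y => f y - g y) (c - d) := by
  simpa [sub_eq_add_neg] using hf.add (hg.const_mul (-1))

theorem sum {ι : Type*} (s : Finset ι) {f : ι → M → ℝ} {c : ι → ℝ}
    (h : ∀ i, HasDirDeriv x v (f i) (c i)) :
    HasDirDeriv x v (fun y => ∑ i ∈ s, f i y) (∑ i ∈ s, c i) := by
  classical
  induction s using Finset.induction_on with
  | empty => simpa using const x v 0
  | insert i s hi ih => simpa only [Finset.sum_insert hi] using (h i).add ih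

theorem congr (hf : HasDirDeriv x v f c) (hfg : f =ᶠ[𝓝 x] g) : HasDirDeriv x v g c := by
  refine ⟨hf.1.congr_of_eventuallyEq hfg.symm, ?_⟩
  rw [← hf.2]
  simp only [mvfderiv, hfg.symm.mfderiv_eq]
  rfl

theorem unique (hf : HasDirDeriv x v f c) (hg : HasDirDeriv x v f d) : c = d :=
  hf.2.symm.trans hg.2

theorem dotProduct {f g : M → Fin n → ℝ} {c d : Fin n → ℝ}
    (hf : ∀ a, HasDirDeriv x v (fun y => f y a) (c a))
    (hg : ∀ a, HasDirDeriv x v (fun y => g y a) (d a)) :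
    HasDirDeriv x v (fun y => f y ⬝ᵥ g y) (c ⬝ᵥ g x + f x ⬝ᵥ d) := by
  have h := sum Finset.univ fun a => (hf a).mul (hg a)
  simpa only [_root_.dotProduct, Finset.sum_add_distrib] using h

end HasDirDeriv

theorem MDifferentiableAt.hasDirDeriv {x : M} {f : M → ℝ}
    (hf : MDifferentiableAt 𝓘(ℝ, E) 𝓘(ℝ, ℝ) f x) (v : TangentSpace 𝓘(ℝ, E) x) :
    HasDirDeriv x v f (mvfderiv 𝓘(ℝ, E) f x v) := ⟨hf, rfl⟩

variable [RiemannianBundle (fun x : M => TangentSpace 𝓘(ℝ, E) x)]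

/-- An orthonormal family of maximal length is an orthonormal basis. -/
theorem exists_orthonormalBasis_eq [FiniteDimensional ℝ E] (hdim : Module.finrank ℝ E = n) {y : M}
    {v : Fin n → TangentSpace 𝓘(ℝ, E) y} (hv : Orthonormal ℝ v) :
    ∃ b : OrthonormalBasis (Fin n) ℝ (TangentSpace 𝓘(ℝ, E) y), ⇑b = v := by
  have hcard : Fintype.card (Fin n) = Module.finrank ℝ (TangentSpace 𝓘(ℝ, E) y) := by
    rw [Fintype.card_fin]
    exact hdim.symm
  have : FiniteDimensional ℝ (TangentSpace 𝓘(ℝ, E) y) := inferInstanceAs (FiniteDimensional ℝ E)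
  have hspan := hv.linearIndependent.span_eq_top_of_card_eq_finrank' hcard
  exact ⟨OrthonormalBasis.mk hv hspan.ge, OrthonormalBasis.coe_mk hv hspan.ge⟩

variable [IsManifold 𝓘(ℝ, E) ∞ M]

/-- The connection coefficients in an orthonormal frame are antisymmetric. -/
theorem connCoeff_antisymm [FiniteDimensional ℝ E]
    {cov : CovariantDerivative 𝓘(ℝ, E) E (fun x : M => TangentSpace 𝓘(ℝ, E) x)}
    (hcov : IsLeviCivita cov) {e : Fin n → Π y : M, TangentSpace 𝓘(ℝ, E) y} {x : M}
    (he : IsOrthonormalFrameAt e x) (l i j : Fin n) :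
    connCoeff cov e x l i j = - connCoeff cov e x l j i := by
  have hd : ∀ i, MDiffAt (T% (e i)) x := fun i => (he.1 i).mdifferentiableAt (by simp)
  have h := hcov.1 x (e l x) (e i) (e j) (hd i) (hd j)
  have hconst : HasDirDeriv x (e l x) (fun y => inner ℝ (e i y) (e j y)) 0 := by
    refine (HasDirDeriv.const x (e l x) (gg i j)).congr ?_
    filter_upwards [he.2] with y hy
    rw [orthonormal_iff_ite.mp hy i j, gg]
  rw [hconst.2] at h
  simp only [connCoeff]
  rw [real_inner_comm (cov (e j) x (e l x))] at h
  linarith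

variable [IsContMDiffRiemannianBundle 𝓘(ℝ, E) ∞ E (fun x : M => TangentSpace 𝓘(ℝ, E) x)]

open InnerProductSpace in
/-- Every orthonormal family of tangent vectors extends to a local orthonormal frame. -/
theorem exists_orthonormalFrameAt (x : M) {b : Fin n → TangentSpace 𝓘(ℝ, E) x}
    (hb : Orthonormal ℝ b) :
    ∃ e : Fin n → Π y : M, TangentSpace 𝓘(ℝ, E) y, IsOrthonormalFrameAt e x ∧
      ∀ i, e i x = b i := by
  let f : Fin n → Π y : M, TangentSpace 𝓘(ℝ, E) y := fun i => FiberBundle.extend E (b i)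
  let g : Fin n → Π y : M, TangentSpace 𝓘(ℝ, E) y := fun i y => gramSchmidt ℝ (fun j => f j y) i
  have hf : ∀ i, f i x = b i := fun i => FiberBundle.extend_apply_self (F := E) (b i)
  have hgx : ∀ i, g i x = b i := by
    intro i
    have h : (fun j => f j x) = b := funext hf
    simp only [g, h]
    rw [gramSchmidt_of_orthogonal ℝ (fun i j hij => hb.2 hij)]
  have hinv : ∀ {u : M → ℝ}, CMDiffAt ∞ u x → u x ≠ 0 → CMDiffAt ∞ (fun y => (u y)⁻¹) x := by
    intro u hu h0
    exact ContDiffAt.comp_contMDiffAt (contDiffAt_inv ℝ h0) hu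
  have hin : ∀ {u v : Π y : M, TangentSpace 𝓘(ℝ, E) y}, CMDiffAt ∞ (T% u) x →
      CMDiffAt ∞ (T% v) x → CMDiffAt ∞ (fun y => inner ℝ (u y) (v y)) x :=
    fun hu hv => ContMDiffAt.inner_bundle (E := fun y : M => TangentSpace 𝓘(ℝ, E) y) hu hv
  -- The Gram-Schmidt recursion as an identity of sections, so that smoothness follows by induction
  -- on i.
  have hgdef : ∀ i, g i = f i - fun y => ∑ j ∈ Finset.Iio i,
      ((fun y => inner ℝ (g j y) (f i y) * (inner ℝ (g j y) (g j y))⁻¹) • g j) y := by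
    intro i
    funext y
    have h := gramSchmidt_def'' ℝ (fun j => f j y) i
    simp only [Pi.sub_apply, Pi.smul_apply']
    rw [eq_sub_iff_add_eq]
    refine Eq.trans ?_ h.symm
    congr 1
    refine Finset.sum_congr rfl fun j _ => ?_
    rw [real_inner_self_eq_norm_sq, div_eq_mul_inv]
    rfl
  have hg : ∀ i, CMDiffAt ∞ (T% (g i)) x := by
    intro i
    induction i using WellFoundedLT.induction with
    | ind i ih =>
      rw [hgdef i]
      refine (FiberBundle.contMDiffAt_extend (k := ∞) 𝓘(ℝ, E) E (b i)).sub_section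
        (ContMDiffAt.sum_section fun j hj => ?_)
      have hj' := ih j (Finset.mem_Iio.mp hj)
      refine ContMDiffAt.smul_section ?_ hj'
      refine (hin hj' (FiberBundle.contMDiffAt_extend (k := ∞) 𝓘(ℝ, E) E (b i))).mul
        (hinv (hin hj' hj') ?_)
      rw [hgx, real_inner_self_eq_norm_sq, hb.1 j]
      norm_num
  have hnorm : ∀ i, CMDiffAt ∞ (fun y => (Real.sqrt (inner ℝ (g i y) (g i y)))⁻¹) x := by
    intro i
    have h1 : inner ℝ (g i x) (g i x) = (1 : ℝ) := by
      rw [hgx, real_inner_self_eq_norm_sq, hb.1 i]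
      norm_num
    refine hinv ?_ ?_
    · refine ContDiffAt.comp_contMDiffAt (g := Real.sqrt) ?_ (hin (hg i) (hg i))
      exact Real.contDiffAt_sqrt (by rw [h1]; norm_num)
    · rw [h1]
      norm_num
  -- Normalising changes nothing at x, where Gram-Schmidt fixes the orthonormal family b.
  refine ⟨fun i => (fun y => (Real.sqrt (inner ℝ (g i y) (g i y)))⁻¹) • g i, ⟨?_, ?_⟩, ?_⟩
  · exact fun i => (hnorm i).smul_section (hg i)
  · have hev : ∀ i, ∀ᶠ y in 𝓝 x, inner ℝ (g i y) (g i y) ≠ (0 : ℝ) := by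
      intro i
      refine (hin (hg i) (hg i)).continuousAt.eventually_ne ?_
      rw [hgx, real_inner_self_eq_norm_sq, hb.1 i]
      norm_num
    filter_upwards [Filter.eventually_all.mpr hev] with y hy
    have hy0 : ∀ i, ‖g i y‖ ≠ 0 := by
      intro i h0
      apply hy i
      rw [real_inner_self_eq_norm_sq, h0]
      norm_num
    constructor
    · intro i
      simp only [Pi.smul_apply']
      rw [real_inner_self_eq_norm_sq, Real.sqrt_sq (norm_nonneg _), norm_smul, norm_inv, norm_norm,
        inv_mul_cancel₀ (hy0 i)]
    · intro i j hij
      simp only [Pi.smul_apply']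
      rw [inner_smul_left, inner_smul_right, show inner ℝ (g i y) (g j y) = (0 : ℝ) from
        gramSchmidt_orthogonal ℝ (fun j => f j y) hij, mul_zero, mul_zero]
  · intro i
    simp only [Pi.smul_apply', hgx]
    rw [real_inner_self_eq_norm_sq, hb.1 i]
    simp

end Frames

/-! ### Connection terms, constant curvature and the pointwise identities. -/

section Components

variable {n : ℕ}

/-- The metric is parallel: the connection terms on its indices cancel by antisymmetry, and only
those on t survive. -/
theorem sum_mul_metricProd {w : Fin n → Fin n → ℝ} (hw : ∀ i j, w i j = - w j i) (t : Fin n → ℝ)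
    (i j k : Fin n) :
    ∑ m, (w i m * metricProd t m j k + w j m * metricProd t i m k + w k m * metricProd t i j m)
      = metricProd (fun k => ∑ m, w k m * t m) i j k := by
  have e : ∀ m, w i m * metricProd t m j k + w j m * metricProd t i m k
      + w k m * metricProd t i j m
      = t k * (w i m * gg m j) + gg j k * (w i m * t m) + t j * (w i m * gg m k)
        + (t k * (w j m * gg m i) + t i * (w j m * gg m k) + gg k i * (w j m * t m))
        + (gg i j * (w k m * t m) + t i * (w k m * gg m j) + t j * (w k m * gg m i)) := by
    intro m
    simp only [metricProd]
    rw [gg_comm k m, gg_comm i m, gg_comm j m]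
    ring
  simp only [e, Finset.sum_add_distrib, ← Finset.mul_sum, sum_mul_gg]
  simp only [metricProd]
  linear_combination t k * hw i j + t j * hw i k + t i * hw j k

theorem ricci_of_constant {R : Fin n → Fin n → Fin n → Fin n → ℝ} {κ : ℝ}
    (hR : ∀ i j k l, R i j k l = κ * (gg i k * gg j l - gg i l * gg j k)) (i j : Fin n) :
    ricci R i j = κ * ((n : ℝ) - 1) * gg i j := by
  have e : ∀ a, R a i a j = κ * (gg a a * gg i j - gg i a * gg a j) := by
    intro a
    rw [hR]
    ring
  simp only [ricci, e, ← Finset.mul_sum, Finset.sum_sub_distrib, ← Finset.sum_mul, sum_gg_self,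
    sum_mul_gg]
  ring

theorem scal_of_constant {R : Fin n → Fin n → Fin n → Fin n → ℝ} {κ : ℝ}
    (hR : ∀ i j k l, R i j k l = κ * (gg i k * gg j l - gg i l * gg j k)) :
    scal R = (n : ℝ) * ((n : ℝ) - 1) * κ := by
  simp only [scal_eq_sum_ricci, ricci_of_constant hR, ← Finset.mul_sum, sum_gg_self]
  ring

theorem traceFree2_mul_gg (hn : 3 ≤ n) (c : ℝ) (i j : Fin n) :
    traceFree2 (fun i j => c * gg i j) i j = 0 := by
  have n0 : (n : ℝ) ≠ 0 := by positivity
  simp only [traceFree2, ← Finset.mul_sum, sum_gg_self]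
  field_simp
  ring

/-- The consequences of the polynomial equations for a structure tensor. -/
theorem PolynomialEquations.sq2_eq_and_curvature (hn : 3 ≤ n) {T : Fin n → Fin n → Fin n → ℝ}
    (h1 : ∀ i j k, T j i k = T i j k) (h2 : ∀ k, ∑ i, T i i k = 0)
    (h3 : ∀ i j k, T i j k + 1 / ((n : ℝ) - 1) * gg i j * tr T k
      = T i k j + 1 / ((n : ℝ) - 1) * gg i k * tr T j)
    {R : Fin n → Fin n → Fin n → Fin n → ℝ} {κ : ℝ}
    (hR : ∀ i j k l, R i j k l = κ * (gg i k * gg j l - gg i l * gg j k))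
    (h : PolynomialEquations T R) :
    (∀ i j, sq2 (ring3 T) i j = ((n : ℝ) - 2) * (contr (ring3 T) (tbar T) i j
        + tbar T i * tbar T j)
      + (sq3 (ring3 T) - ((n : ℝ) - 2) * sq1 (tbar T)) / n * gg i j) ∧
    ∀ i j k l, (ring3 T + metricProd (tbar T)) i k ⬝ᵥ (ring3 T + metricProd (tbar T)) j l
        - (ring3 T + metricProd (tbar T)) j k ⬝ᵥ (ring3 T + metricProd (tbar T)) i l
      = - lam (ring3 T) (tbar T) * (gg i k * gg j l - gg j k * gg i l) := by
  obtain ⟨hY, hW, hZ⟩ := h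
  have hric : ricci R = fun i j => κ * ((n : ℝ) - 1) * gg i j := by
    funext i j
    exact ricci_of_constant hR i j
  have hQ := sq2_eq (κ := κ * ((n : ℝ) - 1)) (Z := Zten T R) (t := tbar T) hn (sum_ring3 T)
    (fun i j => by simp only [Zten, hric]) (fun i j => by
      have e := hZ i j
      rw [hric, traceFree2_mul_gg hn] at e
      linarith)
  refine ⟨hQ, metricProd_curvature hn (ring3_symmetric3 T) ?_ hQ⟩
  refine dotProduct_sub_dotProduct (ring3_symmetric3 T) (sum_ring3 T)
    (weyl_dotProduct_eq_zero hn (ring3_symmetric3 T) (structureTensor_eq hn h1 h2 h3) ?_)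
  intro i j k l
  have e := hY i j k l
  rw [hW] at e
  linarith

end Components

/-! ### Differentiating the identities on the manifold. -/

section Manifold

variable {n : ℕ} {E : Type*} [NormedAddCommGroup E] [NormedSpace ℝ E]
  {M : Type*} [TopologicalSpace M] [ChartedSpace E M]

theorem HasDirDeriv.metricProd {x : M} {v : TangentSpace 𝓘(ℝ, E) x} {t : M → Fin n → ℝ}
    {dt : Fin n → ℝ} (ht : ∀ k, HasDirDeriv x v (fun y => t y k) (dt k)) (i j k : Fin n) :
    HasDirDeriv x v (fun y => metricProd (t y) i j k) (metricProd dt i j k) :=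
  (((ht k).const_mul (gg i j)).add ((ht i).const_mul (gg j k))).add ((ht j).const_mul (gg k i))

theorem exists_hasDirDeriv_ring3 {x : M} (v : TangentSpace 𝓘(ℝ, E) x)
    {T : M → Fin n → Fin n → Fin n → ℝ}
    (hT : ∀ i j k, MDifferentiableAt 𝓘(ℝ, E) 𝓘(ℝ, ℝ) (fun y => T y i j k) x) (i j k : Fin n) :
    ∃ c, HasDirDeriv x v (fun y => ring3 (T y) i j k) c := by
  have hs : ∀ i j k, ∃ c, HasDirDeriv x v (fun y => symm3 (T y) i j k) c := by
    intro i j k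
    have h := fun i j k => MDifferentiableAt.hasDirDeriv (hT i j k) v
    exact ⟨_, (((((h i j k).add (h i k j)).add (h k i j)).add (h k j i)).add (h j k i)).add
      (h j i k)⟩
  choose c hc using hs
  have htr := fun k => HasDirDeriv.sum Finset.univ fun a => hc a a k
  exact ⟨_, ((hc i j k).sub ((((htr k).const_mul (gg i j)).add
    ((htr i).const_mul (gg j k))).add ((htr j).const_mul (gg k i)) |>.const_mul
      (1 / ((n : ℝ) + 2)))).const_mul (1 / 6)⟩

theorem exists_hasDirDeriv_tbar {x : M} (v : TangentSpace 𝓘(ℝ, E) x)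
    {T : M → Fin n → Fin n → Fin n → ℝ}
    (hT : ∀ i j k, MDifferentiableAt 𝓘(ℝ, E) 𝓘(ℝ, ℝ) (fun y => T y i j k) x) (i : Fin n) :
    ∃ c, HasDirDeriv x v (fun y => tbar (T y) i) c :=
  ⟨_, (HasDirDeriv.sum Finset.univ fun j =>
    MDifferentiableAt.hasDirDeriv (hT i j j) v).const_mul _⟩

theorem exists_hasDirDeriv_lam {x : M} {v : TangentSpace 𝓘(ℝ, E) x}
    {S : M → Fin n → Fin n → Fin n → ℝ} {t : M → Fin n → ℝ}
    (hS : ∀ i j k, ∃ c, HasDirDeriv x v (fun y => S y i j k) c)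
    (ht : ∀ i, ∃ c, HasDirDeriv x v (fun y => t y i) c) :
    ∃ c, HasDirDeriv x v (fun y => lam (S y) (t y)) c := by
  choose c hc using hS
  choose d hd using ht
  have h3 := HasDirDeriv.sum Finset.univ fun i => HasDirDeriv.sum Finset.univ fun j =>
    HasDirDeriv.sum Finset.univ fun k => (hc i j k).mul (hc i j k)
  have h1 := HasDirDeriv.sum Finset.univ fun i => (hd i).mul (hd i)
  exact ⟨_, (h3.sub (h1.const_mul (((n : ℝ) - 1) * ((n : ℝ) + 2)))).mul_const
    ((n : ℝ) * ((n : ℝ) - 1))⁻¹⟩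

variable [IsManifold 𝓘(ℝ, E) ∞ M] [RiemannianBundle (fun x : M => TangentSpace 𝓘(ℝ, E) x)]
  {cov : CovariantDerivative 𝓘(ℝ, E) E (fun x : M => TangentSpace 𝓘(ℝ, E) x)}
  {T : Π x : M, TangentSpace 𝓘(ℝ, E) x →L[ℝ] TangentSpace 𝓘(ℝ, E) x →L[ℝ]
      TangentSpace 𝓘(ℝ, E) x →L[ℝ] ℝ}

theorem IsSmoothTensor.mdifferentiableAt_comp (hsmooth : IsSmoothTensor T)
    {e : Fin n → Π y : M, TangentSpace 𝓘(ℝ, E) y} {x : M} (he : IsOrthonormalFrameAt e x)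
    (i j k : Fin n) :
    MDifferentiableAt 𝓘(ℝ, E) 𝓘(ℝ, ℝ) (fun y => comp T y (fun i => e i y) i j k) x :=
  (hsmooth x _ _ _ (he.1 i) (he.1 j) (he.1 k)).mdifferentiableAt (by simp)

theorem riem_of_constant {κ : ℝ}
    (hκ : ∀ (x : M) (u v w : TangentSpace 𝓘(ℝ, E) x),
      curvature cov x u v w = κ • (inner ℝ v w • u - inner ℝ u w • v)) {x : M}
    {v : Fin n → TangentSpace 𝓘(ℝ, E) x} (hv : Orthonormal ℝ v) (i j k l : Fin n) :
    riem cov x v i j k l = κ * (gg i k * gg j l - gg i l * gg j k) := by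
  have h : ∀ i j, inner ℝ (v i) (v j) = gg i j := fun i j => by
    rw [orthonormal_iff_ite.mp hv i j, gg]
  simp only [riem, hκ, inner_smul_left, inner_sub_left, h, RCLike.conj_to_real]
  rw [gg_comm l j, gg_comm k i, gg_comm k j, gg_comm l i]
  ring

variable [FiniteDimensional ℝ E]

/-- At every point, either `P = S + metricProd t` vanishes or `lam` is nine times the
curvature. -/
theorem mul_add_metricProd_eq_zero (hn : 3 ≤ n) (hdim : Module.finrank ℝ E = n)
    (hcov : IsLeviCivita cov) {κ : ℝ}
    (hκ : ∀ (x : M) (u v w : TangentSpace 𝓘(ℝ, E) x),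
      curvature cov x u v w = κ • (inner ℝ v w • u - inner ℝ u w • v))
    (hsmooth : IsSmoothTensor T) (hT : IsStructureTensor (n := n) T)
    (hpol : ∀ (x : M) (b : OrthonormalBasis (Fin n) ℝ (TangentSpace 𝓘(ℝ, E) x)),
      PolynomialEquations (comp T x b) (riem cov x b))
    {e : Fin n → Π y : M, TangentSpace 𝓘(ℝ, E) y} {x : M} (he : IsOrthonormalFrameAt e x)
    (hder : DerivativeEquations cov T e x) (i j k : Fin n) :
    (lam (ring3 (comp T x fun i => e i x)) (tbar (comp T x fun i => e i x)) - 9 * κ)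
      * (ring3 (comp T x fun i => e i x) + metricProd (tbar (comp T x fun i => e i x))) i j k
      = 0 := by
  obtain ⟨-, hS, ht⟩ := hder
  set Tc : M → Fin n → Fin n → Fin n → ℝ := fun y => comp T y fun i => e i y with hTc
  set S : M → Fin n → Fin n → Fin n → ℝ := fun y => ring3 (Tc y) with hSdef
  set t : M → Fin n → ℝ := fun y => tbar (Tc y) with htdef
  set P : M → Fin n → Fin n → Fin n → ℝ := fun y => S y + metricProd (t y) with hP
  -- The identities are needed on a neighbourhood of x, not only at x, since they are to be
  -- differentiated.
  have hfacts : ∀ y, Orthonormal ℝ (fun i => e i y) →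
      (∀ i j, sq2 (S y) i j = ((n : ℝ) - 2) * (contr (S y) (t y) i j + t y i * t y j)
        + (sq3 (S y) - ((n : ℝ) - 2) * sq1 (t y)) / n * gg i j) ∧
      ∀ i j k l, P y i k ⬝ᵥ P y j l - P y j k ⬝ᵥ P y i l
        = - lam (S y) (t y) * (gg i k * gg j l - gg j k * gg i l) := by
    intro y hy
    obtain ⟨b, hb⟩ := exists_orthonormalBasis_eq hdim hy
    obtain ⟨h1, h2, h3⟩ := hT y b
    have hp := hpol y b
    rw [hb] at h1 h2 h3 hp
    exact hp.sq2_eq_and_curvature hn h1 h2 h3 (riem_of_constant hκ hy)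
  have hx : Orthonormal ℝ (fun i => e i x) := he.2.self_of_nhds
  obtain ⟨hQ, hC⟩ := hfacts x hx
  have hsymm : Symmetric3 (P x) :=
    (ring3_symmetric3 _).add (metricProd_symmetric3 _)
  have hTd : ∀ i j k, MDifferentiableAt 𝓘(ℝ, E) 𝓘(ℝ, ℝ) (fun y => Tc y i j k) x :=
    hsmooth.mdifferentiableAt_comp he
  have key : ∀ m, ∃ c : ℝ, ∀ i j k l,
      (lam (S x) (t x) - 9 * κ) * kulkarni (P x m) i j k l
        = c * (gg i k * gg j l - gg j k * gg i l) := by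
    intro m
    set w : Fin n → Fin n → ℝ := connCoeff cov e x m with hw
    have hwa : ∀ i j, w i j = - w j i := connCoeff_antisymm hcov he m
    have eS := exists_hasDirDeriv_ring3 (e m x) hTd
    have et := exists_hasDirDeriv_tbar (e m x) hTd
    obtain ⟨dL, hdL⟩ := exists_hasDirDeriv_lam eS et
    choose dS hdS using eS
    choose dt hdt using et
    have hdP : ∀ i j k, HasDirDeriv x (e m x) (fun y => P y i j k) ((dS + metricProd dt) i j k) :=
      fun i j k => (hdS i j k).add (HasDirDeriv.metricProd hdt i j k)
    -- The formulas for S and t add up to the covariant derivative of P, as `metricProd` commutes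
    -- with ∇.
    have hDP : ∀ i j k, quadDeriv (P x) (5 / 18 * lam (S x) (t x) + 3 / 2 * κ) m i j k
        = (dS + metricProd dt) i j k
          - ∑ p, (w i p * P x p j k + w j p * P x i p k + w k p * P x i j p) := by
      intro i j k
      rw [← rhsRing_add_metricProd hn (ring3_symmetric3 _) (sum_ring3 _) hQ hC κ i j k m]
      have hscal : scal (riem cov x fun i => e i x) = (n : ℝ) * ((n : ℝ) - 1) * κ :=
        scal_of_constant (riem_of_constant hκ hx)
      have a1 : (fun k => rhsTbar (S x) (t x) ((n : ℝ) * ((n : ℝ) - 1) * κ) k m)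
          = dt - fun k => ∑ p, w k p * t x p := by
        funext k
        rw [← hscal, ← ht k m]
        simp only [covD1, Pi.sub_apply]
        rw [(hdt k).2]
      have a2 : rhsRing (S x) (t x) i j k m = dS i j k
          - ∑ p, (w i p * S x p j k + w j p * S x i p k + w k p * S x i j p) := by
        rw [← hS i j k m]
        simp only [covD3]
        rw [(hdS i j k).2]
      have a3 := sum_mul_metricProd hwa (t x) i j k
      have a4 : ∑ p, (w i p * P x p j k + w j p * P x i p k + w k p * P x i j p)
          = ∑ p, (w i p * S x p j k + w j p * S x i p k + w k p * S x i j p)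
            + ∑ p, (w i p * metricProd (t x) p j k + w j p * metricProd (t x) i p k
              + w k p * metricProd (t x) i j p) := by
        rw [← Finset.sum_add_distrib]
        refine Finset.sum_congr rfl fun p _ => ?_
        simp only [hP, Pi.add_apply]
        ring
      rw [a4, a3, a2, a1]
      simp only [Pi.add_apply, metricProd, Pi.sub_apply]
      ring
    -- With μ = 5λ/18 + 3κ/2 one has μ - 4λ/9 = -(λ - 9κ)/6; this produces both the 6 and the 9.
    refine ⟨6 * dL, fun i j k l => ?_⟩
    have hd := HasDirDeriv.dotProduct (hdP i k) (hdP j l)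
    have hd' := HasDirDeriv.dotProduct (hdP j k) (hdP i l)
    have hl := (hdL.const_mul (-1)).mul_const (gg i k * gg j l - gg j k * gg i l)
    have heq := (hd.sub hd').unique (hl.congr (by
      filter_upwards [he.2] with y hy
      rw [(hfacts y hy).2 i j k l]
      ring))
    have h1 := covariant_curvature hwa hDP hC i j k l
    have h2 := quadDeriv_curvature hsymm hC (5 / 18 * lam (S x) (t x) + 3 / 2 * κ) i j k l m
    rw [h1] at h2
    linear_combination 6 * h2 - 6 * heq
  choose c hc using key
  exact mul_eq_zero_of_kulkarni hn hsymm hc i j k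

end Manifold

end Superintegrable

end

/-! ### From the pointwise alternative to the scalar identity. -/

theorem mainTheorem9 {n : ℕ} (hn : 3 ≤ n)
    {E : Type*} [NormedAddCommGroup E] [NormedSpace ℝ E] [FiniteDimensional ℝ E]
    (hdim : Module.finrank ℝ E = n)
    {M : Type*} [TopologicalSpace M] [ChartedSpace E M]
    [IsManifold 𝓘(ℝ, E) ∞ M] [RiemannianBundle (fun x : M => TangentSpace 𝓘(ℝ, E) x)]
    [IsContMDiffRiemannianBundle 𝓘(ℝ, E) ∞ E
      (fun x : M => TangentSpace 𝓘(ℝ, E) x)]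
    (cov : CovariantDerivative 𝓘(ℝ, E) E
      (fun x : M => TangentSpace 𝓘(ℝ, E) x))
    (hcov : Superintegrable.IsLeviCivita cov)
    (hcurv : Superintegrable.HasConstantCurvature cov)
    (T : Π x : M, TangentSpace 𝓘(ℝ, E) x →L[ℝ] TangentSpace 𝓘(ℝ, E) x →L[ℝ]
      TangentSpace 𝓘(ℝ, E) x →L[ℝ] ℝ)
    (hsmooth : Superintegrable.IsSmoothTensor T)
    (hT : Superintegrable.IsStructureTensor (n := n) T)
    (hder : ∀ (x : M) (e : Fin n → Π y : M, TangentSpace 𝓘(ℝ, E) y),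
      Superintegrable.IsOrthonormalFrameAt e x → Superintegrable.DerivativeEquations cov T e x)
    (hpol : ∀ (x : M) (b : OrthonormalBasis (Fin n) ℝ (TangentSpace 𝓘(ℝ, E) x)),
      Superintegrable.PolynomialEquations (Superintegrable.comp T x b)
        (Superintegrable.riem cov x b)) :
    ∀ (x : M) (b : OrthonormalBasis (Fin n) ℝ (TangentSpace 𝓘(ℝ, E) x)),
      Superintegrable.sq3 (Superintegrable.ring3 (Superintegrable.comp T x b))
          - ((n : ℝ) - 1) * ((n : ℝ) + 2)
            * Superintegrable.sq1 (Superintegrable.tbar (Superintegrable.comp T x b))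
        = 9 * Superintegrable.scal (Superintegrable.riem cov x b) := by
  have hn' : (3 : ℝ) ≤ n := by exact_mod_cast hn
  have n0 : (n : ℝ) ≠ 0 := by linarith
  have n1 : (n : ℝ) - 1 ≠ 0 := by linarith
  obtain ⟨κ, hκ⟩ := hcurv
  have hpoint : ∀ (x : M) (b : OrthonormalBasis (Fin n) ℝ (TangentSpace 𝓘(ℝ, E) x)),
      ∀ i j k, (Superintegrable.lam (Superintegrable.ring3 (Superintegrable.comp T x b))
          (Superintegrable.tbar (Superintegrable.comp T x b)) - 9 * κ)
        * (Superintegrable.ring3 (Superintegrable.comp T x b)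
          + Superintegrable.metricProd (Superintegrable.tbar (Superintegrable.comp T x b))) i j k
        = 0 := by
    intro x b i j k
    obtain ⟨e, he, hex⟩ := Superintegrable.exists_orthonormalFrameAt x b.orthonormal
    have h := Superintegrable.mul_add_metricProd_eq_zero hn hdim hcov hκ hsmooth hT hpol he
      (hder x e he) i j k
    rwa [show (fun i => e i x) = b from funext hex] at h
  intro x b
  suffices hlam : Superintegrable.lam (Superintegrable.ring3 (Superintegrable.comp T x b))
      (Superintegrable.tbar (Superintegrable.comp T x b)) = 9 * κ by
    rw [Superintegrable.scal_of_constant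
      (Superintegrable.riem_of_constant hκ b.orthonormal)]
    rw [Superintegrable.lam, div_eq_iff (mul_ne_zero n0 n1)] at hlam
    linear_combination hlam
  -- The alternative P = 0 at x alone is not enough: the derivative of t is needed too. Continuity
  -- of λ - 9κ spreads P = 0 to a neighbourhood.
  by_contra hne
  obtain ⟨e, he, hex⟩ := Superintegrable.exists_orthonormalFrameAt x b.orthonormal
  have hexb : (fun i => e i x) = b := funext hex
  set Tc : M → Fin n → Fin n → Fin n → ℝ :=
    fun y => Superintegrable.comp T y fun i => e i y with hTc
  have hTx : Tc x = Superintegrable.comp T x b := by rw [hTc, ← hexb]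
  have hTd := fun i j k => hsmooth.mdifferentiableAt_comp he i j k
  have hcont : ContinuousAt (fun y => Superintegrable.lam (Superintegrable.ring3 (Tc y))
      (Superintegrable.tbar (Tc y))) x := by
    -- The zero direction is a dummy; only differentiability is used.
    obtain ⟨c, hc⟩ := Superintegrable.exists_hasDirDeriv_lam
      (Superintegrable.exists_hasDirDeriv_ring3 (0 : TangentSpace 𝓘(ℝ, E) x) hTd)
      (Superintegrable.exists_hasDirDeriv_tbar (0 : TangentSpace 𝓘(ℝ, E) x) hTd)
    exact hc.1.continuousAt
  have hzero : ∀ᶠ y in 𝓝 x, Superintegrable.ring3 (Tc y)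
      + Superintegrable.metricProd (Superintegrable.tbar (Tc y)) = 0 := by
    have hne' := hcont.eventually_ne (y := 9 * κ) (by rw [hTx]; exact hne)
    filter_upwards [hne', he.2] with y hy hyo
    obtain ⟨b', hb'⟩ := Superintegrable.exists_orthonormalBasis_eq hdim hyo
    funext i j k
    have h := hpoint y b' i j k
    rw [hb'] at h
    exact (mul_eq_zero.mp h).resolve_left (sub_ne_zero.mpr hy)
  have ht0 : ∀ᶠ y in 𝓝 x, Superintegrable.tbar (Tc y) = 0 := by
    filter_upwards [hzero] with y hy
    have h := Superintegrable.sum_add_metricProd (Superintegrable.sum_ring3 (Tc y))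
      (Superintegrable.tbar (Tc y))
    rw [hy] at h
    have n2 : (n : ℝ) + 2 ≠ 0 := by positivity
    simpa [n2] using h.symm
  have htx := ht0.self_of_nhds
  have hSx : Superintegrable.ring3 (Tc x) = 0 := by
    have h := hzero.self_of_nhds
    rw [htx] at h
    funext i j k
    simpa [Superintegrable.metricProd] using congrFun (congrFun (congrFun h i) j) k
  have hlam0 : Superintegrable.lam (Superintegrable.ring3 (Tc x))
      (Superintegrable.tbar (Tc x)) = 0 := by
    simp [Superintegrable.lam, hSx, htx, Superintegrable.sq3, Superintegrable.sq1]
  have i0 : Fin n := ⟨0, by omega⟩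
  have hder0 := (hder x e he).2.2 i0 i0
  have hd0 : Superintegrable.covD1 cov e (fun y => Superintegrable.tbar (Tc y)) x i0 i0 = 0 := by
    have hc : Superintegrable.HasDirDeriv x (e i0 x)
        (fun y => Superintegrable.tbar (Tc y) i0) 0 := by
      refine (Superintegrable.HasDirDeriv.const x (e i0 x) 0).congr ?_
      filter_upwards [ht0] with y hy
      rw [hy]
      rfl
    simp only [Superintegrable.covD1, hc.2, htx]
    simp
  have hs : Superintegrable.scal (Superintegrable.riem cov x fun i => e i x)
      = (n : ℝ) * ((n : ℝ) - 1) * κ :=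
    Superintegrable.scal_of_constant (Superintegrable.riem_of_constant hκ he.2.self_of_nhds)
  -- With S = t = 0 at x and t locally zero, a diagonal entry of the formula for t̄_{k,l} reduces to
  -- 0 = 3κ/2.
  have hκ0 : κ = 0 := by
    have h : Superintegrable.rhsTbar (Superintegrable.ring3 (Tc x)) (Superintegrable.tbar (Tc x))
        ((n : ℝ) * ((n : ℝ) - 1) * κ) i0 i0 = 0 := by
      rw [← hs, ← hd0]
      exact hder0.symm
    rw [hSx, htx] at h
    simp [Superintegrable.rhsTbar, Superintegrable.traceFree2, Superintegrable.sq2,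
      Superintegrable.contr, Superintegrable.sq3, Superintegrable.sq1, Superintegrable.gg_self, n0,
      n1] at h
    exact h
  rw [← hTx, hlam0, hκ0, mul_zero] at hne
  exact hne rfl
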